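/- Let $\Sigma=\{(x,y,z)\in\mathbb R^3: 0<y<1\}$. All functions are real-valued. Let $H^1_\star(\Sigma)$ be the completion of the class of smooth functions on $\overline\Sigma$ which, together with all their derivatives, decay rapidly as $|(x,z)|\to\infty$, with respect to the norm $\|u\|_\star^2=\int_\Sigma (u_x^2+u_y^2+u_z^2)\,dx\,dy\,dz$. Let $H_\star^{1/2}(\mathbb R^2)$ be the completion of the Schwartz class $\mathcal S(\mathbb R^2)$ with respect to the norm $\|\Phi\|_{\star,1/2}^2=\int_{\mathbb R^2}(1+|k|^2)^{-1/2}|k|^2|\hat\Phi|^2\,dk$, and let $H_\star^{-1/2}(\mathbb R^2)$ be the completion of the class of Schwartz functions with zero mean with respect to the norm $\|\xi\|_{\star,-1/2}^2=\int_{\mathbb R^2}(1+|k|^2)^{1/2}|k|^{-2}|\hat\xi|^2\,dk$, where $\hat{\ }$ is the unitary Fourier transform. The trace map $u\mapsto u|_{y=1}$, $H^1_\star(\Sigma)\to H^{1/2}_\star(\mathbb R^2)$, and the pairing $\int_{\mathbb R^2}\xi\Phi\,dx\,dz$ of $\xi\in H_\star^{-1/2}(\mathbb R^2)$ with $\Phi\in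 H_\star^{1/2}(\mathbb R^2)$ are defined by continuous extension. The space $W^{1,\infty}(\mathbb R^2)$ of functions $\eta=\eta(x,z)$ has the norm $\|\eta\|_{1,\infty}=\max(\|\eta\|_\infty,\|\eta_x\|_\infty,\|\eta_z\|_\infty)$. For $\eta\in W^{1,\infty}(\mathbb R^2)$ with $\|\eta\|_{1,\infty}<\tfrac12$ and $\xi\in H_\star^{-1/2}(\mathbb R^2)$, a weak solution of the (flattened) boundary-value problem $$u_{xx}+u_{yy}+u_{zz}=\partial_xF_1+\partial_zF_2+\partial_yF_3\ (0<y<1),\qquad u_y=F_3+\xi\ (y=1),\qquad u_y=0\ (y=0),$$ where $$F_1=-\eta u_x+y\eta_xu_y,\qquad F_2=-\eta u_z+y\eta_zu_y,\qquad F_3=\frac{\eta u_y}{1+\eta}+y\eta_xu_x+y\eta_zu_z-\frac{y^2}{1+\eta}(\eta_x^2+\eta_z^2)u_y,$$ is a function $u\in H^1_\star(\Sigma)$ such that $$\int_\Sigma(u_xw_x+u_yw_y+u_zw_z)\,dx\,dy\,dz=\int_\Sigma(F_1w_x+F_2w_z+F_3w_y)\,dx\,dy\,dz+\int_{\mathbb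 R^2}\xi\,w|_{y=1}\,dx\,dz\qquad\text{for all } w\in H_\star^1(\Sigma).$$ Then the following hold. (i) For each $\eta$ with $\|\eta\|_{1,\infty}<\frac12$ and each $\xi\in H^{-1/2}_\star(\mathbb R^2)$ there is a unique weak solution $u$, and $N(\eta)\xi:=u|_{y=1}$ defines a bounded linear operator $N(\eta):H^{-1/2}_\star(\mathbb R^2)\to H_\star^{1/2}(\mathbb R^2)$ (the Neumann--Dirichlet operator). (ii) The mapping $\eta\mapsto N(\eta)$ from $W^{1,\infty}(\mathbb R^2)$ to $\mathcal L(H_\star^{-1/2}(\mathbb R^2),H_\star^{1/2}(\mathbb R^2))$ is analytic at the origin, that is, near the origin it is the sum of a convergent power series of bounded multilinear operators in $\eta$ with positive radius of convergence. (iii) There are constants $M\in(0,\frac12]$ and $c,C>0$ such that for each $\eta$ with $\|\eta\|_{1,\infty}<M$ the operator $N(\eta)$ is an isomorphism, and its inverse, the Dirichlet--Neumann operator $G(\eta)=N(\eta)^{-1}:H_\star^{1/2}(\mathbb R^2)\to H_\star^{-1/2}(\mathbb R^2)$, satisfies $$c\,\|\Phi\|_{\star,1/2}^2\le\int_{\mathbb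 R^2}\Phi\,G(\eta)\Phi\,dx\,dz\le C\,\|\Phi\|_{\star,1/2}^2\qquad\text{for all }\Phi\in H_\star^{1/2}(\mathbb R^2).$$ The mapping $\eta\mapsto G(\eta)$ from $W^{1,\infty}(\mathbb R^2)$ to $\mathcal L(H_\star^{1/2}(\mathbb R^2),H_\star^{-1/2}(\mathbb R^2))$ is analytic at the origin. -/

import Mathlib

open MeasureTheory Set
open scoped ENNReal SchwartzMap FourierTransform LineDeriv

noncomputable section

namespace WaterWaves

/-- The horizontal plane; the coordinates are `(x, z)`. -/
abbrev Plane : Type := EuclideanSpace ℝ (Fin 2)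

/-- Three-dimensional space; a point `((x, z), y)` has the horizontal coordinates `(x, z)` and the
vertical coordinate `y`. -/
abbrev Space : Type := Plane × ℝ

/-- The slab `Σ = {0 < y < 1}`. -/
def slab : Set Space := {p | 0 < p.2 ∧ p.2 < 1}

/-- Lebesgue measure on the slab. -/
def slabMeasure : Measure Space := volume.restrict slab

/-- The unit vectors of the `x` and `z` directions in the plane. -/
def planeX : Plane := EuclideanSpace.single 0 1

def planeZ : Plane := EuclideanSpace.single 1 1

/-- The unit vectors of the `x`, `z` and `y` directions in space. -/
def dirX : Space := (planeX, 0)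

def dirZ : Space := (planeZ, 0)

def dirY : Space := (0, 1)

/-! ### The space `W^{1,∞}(ℝ²)` -/

/-- `g` is the weak derivative of `f` in the direction `e`. -/
def IsWeakDeriv (e : Plane) (f g : Plane → ℝ) : Prop :=
  ∀ φ : Plane → ℝ, ContDiff ℝ (⊤ : ℕ∞) φ → HasCompactSupport φ →
    ∫ v, f v * fderiv ℝ φ v e = -∫ v, g v * φ v

theorem integrable_mul_test (f : Lp ℝ ∞ (volume : Measure Plane)) {φ : Plane → ℝ}
    (h : Continuous φ) (hc : HasCompactSupport φ) : Integrable (fun v => f v * φ v) := by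
  have h1 : Integrable φ := h.integrable_of_hasCompactSupport hc
  have h2 := (Lp.memLp f)
  exact (h1.mul_of_top_right h2).congr (.of_forall fun v => rfl)

theorem integrable_mul_test_deriv (f : Lp ℝ ∞ (volume : Measure Plane)) {φ : Plane → ℝ}
    (e : Plane) (h : ContDiff ℝ (⊤ : ℕ∞) φ) (hc : HasCompactSupport φ) :
    Integrable (fun v => f v * fderiv ℝ φ v e) := by
  refine integrable_mul_test f ?_ ?_
  · exact (h.continuous_fderiv (by simp)).clm_apply continuous_const
  · exact hc.fderiv_apply (𝕜 := ℝ) e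

theorem isWeakDeriv_zero (e : Plane) :
    IsWeakDeriv e (0 : Lp ℝ ∞ (volume : Measure Plane)) (0 : Lp ℝ ∞ (volume : Measure Plane)) := by
  intro φ _ _
  simp

theorem IsWeakDeriv.add {e : Plane} {f₁ g₁ f₂ g₂ : Lp ℝ ∞ (volume : Measure Plane)}
    (h₁ : IsWeakDeriv e f₁ g₁) (h₂ : IsWeakDeriv e f₂ g₂) :
    IsWeakDeriv e (f₁ + f₂ : Lp ℝ ∞ (volume : Measure Plane))
      (g₁ + g₂ : Lp ℝ ∞ (volume : Measure Plane)) := by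
  intro φ hφ hc
  have e1 : ∫ v, (f₁ + f₂ : Lp ℝ ∞ (volume : Measure Plane)) v * fderiv ℝ φ v e
      = ∫ v, (f₁ v * fderiv ℝ φ v e + f₂ v * fderiv ℝ φ v e) := by
    apply integral_congr_ae
    filter_upwards [Lp.coeFn_add f₁ f₂] with v hv
    rw [hv, Pi.add_apply, add_mul]
  have e2 : ∫ v, (g₁ + g₂ : Lp ℝ ∞ (volume : Measure Plane)) v * φ v
      = ∫ v, (g₁ v * φ v + g₂ v * φ v) := by
    apply integral_congr_ae
    filter_upwards [Lp.coeFn_add g₁ g₂] with v hv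
    rw [hv, Pi.add_apply, add_mul]
  rw [e1, e2, integral_add (integrable_mul_test_deriv f₁ e hφ hc)
    (integrable_mul_test_deriv f₂ e hφ hc), integral_add (integrable_mul_test g₁ hφ.continuous hc)
    (integrable_mul_test g₂ hφ.continuous hc), h₁ φ hφ hc, h₂ φ hφ hc]
  ring

theorem IsWeakDeriv.smul {e : Plane} {f g : Lp ℝ ∞ (volume : Measure Plane)} (c : ℝ)
    (h : IsWeakDeriv e f g) :
    IsWeakDeriv e (c • f : Lp ℝ ∞ (volume : Measure Plane))
      (c • g : Lp ℝ ∞ (volume : Measure Plane)) := by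
  intro φ hφ hc
  have e1 : ∫ v, (c • f : Lp ℝ ∞ (volume : Measure Plane)) v * fderiv ℝ φ v e
      = ∫ v, c * (f v * fderiv ℝ φ v e) := by
    apply integral_congr_ae
    filter_upwards [Lp.coeFn_smul c f] with v hv
    rw [hv, Pi.smul_apply, smul_eq_mul, mul_assoc]
  have e2 : ∫ v, (c • g : Lp ℝ ∞ (volume : Measure Plane)) v * φ v = ∫ v, c * (g v * φ v) := by
    apply integral_congr_ae
    filter_upwards [Lp.coeFn_smul c g] with v hv
    rw [hv, Pi.smul_apply, smul_eq_mul, mul_assoc]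
  rw [e1, e2, integral_const_mul, integral_const_mul, h φ hφ hc]
  ring

/-- The Sobolev space `W^{1,∞}(ℝ²)` of real-valued functions: a function `η` is stored together with
its weak derivatives, as the triple `(η, η_x, η_z)`. The norm is the maximum of the three
`L^∞` norms. -/
def W1inf : Submodule ℝ (Lp ℝ ∞ (volume : Measure Plane) ×
    Lp ℝ ∞ (volume : Measure Plane) × Lp ℝ ∞ (volume : Measure Plane)) where
  carrier := {η | IsWeakDeriv planeX η.1 η.2.1 ∧ IsWeakDeriv planeZ η.1 η.2.2}
  zero_mem' := ⟨isWeakDeriv_zero _, isWeakDeriv_zero _⟩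
  add_mem' h₁ h₂ := ⟨h₁.1.add h₂.1, h₁.2.add h₂.2⟩
  smul_mem' c _ h := ⟨h.1.smul c, h.2.smul c⟩

/-- The function `η`. -/
def surf (η : W1inf) : Plane → ℝ := η.1.1

/-- The weak derivative `η_x`. -/
def surfX (η : W1inf) : Plane → ℝ := η.1.2.1

/-- The weak derivative `η_z`. -/
def surfZ (η : W1inf) : Plane → ℝ := η.1.2.2

/-! ### The spaces `H_⋆^{1/2}(ℝ²)` and `H_⋆^{-1/2}(ℝ²)` -/

/-- The Fourier transform of a real-valued Schwartz function on the plane, with Mathlib's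
normalisation `∫ exp (-2 π i ⟨v, κ⟩) f v dv`. In the unitary normalisation
`f̂ k = (2π)⁻¹ ∫ exp (-i ⟨v, k⟩) f v dv` one has `f̂ (2 π κ) = (2π)⁻¹ (fourierReal f) κ`, so that
`∫ m |k| |f̂ k|² dk = ∫ m (2 π |κ|) |(fourierReal f) κ|² dκ`. -/
def fourierReal : 𝓢(Plane, ℝ) →ₗ[ℝ] 𝓢(Plane, ℂ) where
  toFun f := 𝓕 (f.postcompCLM Complex.ofRealCLM)
  map_add' f g := by simp [FourierTransform.fourier_add]
  map_smul' c f := by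
    have h : (c • f).postcompCLM Complex.ofRealCLM
        = (c : ℂ) • (f.postcompCLM Complex.ofRealCLM) := by
      ext v
      simp
    rw [h, FourierTransform.fourier_smul]
    ext v
    simp

/-- The length of the wave vector that belongs to the frequency `κ`. -/
def waveNumber (κ : Plane) : ℝ := 2 * Real.pi * ‖κ‖

/-- The square root of the weight `(1 + |k|²)^{-1/2} |k|²`. -/
def weightPos (κ : Plane) : ℝ := (1 + waveNumber κ ^ 2) ^ (-(1 / 4) : ℝ) * waveNumber κ

/-- The square root of the weight `(1 + |k|²)^{1/2} |k|⁻²`. -/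
def weightNeg (κ : Plane) : ℝ := (1 + waveNumber κ ^ 2) ^ (1 / 4 : ℝ) * (waveNumber κ)⁻¹

theorem memLp_poly_mul (g : 𝓢(Plane, ℂ)) :
    MemLp (fun κ => ((1 + waveNumber κ ^ 2 : ℝ) : ℂ) * g κ) 2 := by
  have ht : (fun κ : Plane => ((1 + waveNumber κ ^ 2 : ℝ) : ℂ)).HasTemperateGrowth := by
    unfold waveNumber
    simp only [mul_pow]
    fun_prop
  have := (SchwartzMap.smulLeftCLM ℂ (fun κ : Plane => ((1 + waveNumber κ ^ 2 : ℝ) : ℂ)) g).memLp 2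
    (volume : Measure Plane)
  refine this.congr_norm ?_ ?_
  · have h1 : Continuous (fun κ : Plane => ((1 + waveNumber κ ^ 2 : ℝ) : ℂ)) := by
      unfold waveNumber
      fun_prop
    exact (h1.mul g.continuous).aestronglyMeasurable
  · filter_upwards with κ
    rw [SchwartzMap.smulLeftCLM_apply_apply ht, smul_eq_mul]

theorem measurable_weightPos : Measurable weightPos := by
  unfold weightPos waveNumber
  fun_prop

theorem measurable_weightNeg : Measurable weightNeg := by
  unfold weightNeg waveNumber
  fun_prop

theorem waveNumber_nonneg (κ : Plane) : 0 ≤ waveNumber κ := by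
  unfold waveNumber
  positivity

theorem weightPos_nonneg (κ : Plane) : 0 ≤ weightPos κ := by
  have := waveNumber_nonneg κ
  unfold weightPos
  positivity

theorem weightNeg_nonneg (κ : Plane) : 0 ≤ weightNeg κ := by
  have := waveNumber_nonneg κ
  unfold weightNeg
  positivity

theorem weightPos_le (κ : Plane) : weightPos κ ≤ waveNumber κ := by
  have h := waveNumber_nonneg κ
  unfold weightPos
  have h1 : (1 + waveNumber κ ^ 2) ^ (-(1 / 4) : ℝ) ≤ 1 :=
    Real.rpow_le_one_of_one_le_of_nonpos (by nlinarith) (by norm_num)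
  nlinarith

theorem weightNeg_le (κ : Plane) : weightNeg κ ≤ (1 + waveNumber κ ^ 2) * (waveNumber κ)⁻¹ := by
  have h := waveNumber_nonneg κ
  unfold weightNeg
  have h1 : (1 + waveNumber κ ^ 2) ^ (1 / 4 : ℝ) ≤ 1 + waveNumber κ ^ 2 :=
    Real.rpow_le_self_of_one_le (by nlinarith) (by norm_num)
  gcongr

theorem memLp_weightPos (f : 𝓢(Plane, ℝ)) :
    MemLp (fun κ => (weightPos κ : ℂ) * fourierReal f κ) 2 := by
  refine (memLp_poly_mul (fourierReal f)).mono ?_ ?_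
  · exact ((Complex.measurable_ofReal.comp measurable_weightPos).mul
      (fourierReal f).continuous.measurable).aestronglyMeasurable
  · filter_upwards with κ
    rw [norm_mul, norm_mul, Complex.norm_real, Complex.norm_real, Real.norm_eq_abs,
      Real.norm_eq_abs, abs_of_nonneg (weightPos_nonneg κ), abs_of_nonneg (by positivity)]
    gcongr
    nlinarith [weightPos_le κ, waveNumber_nonneg κ, sq_nonneg (waveNumber κ - 1)]

/-- The Schwartz functions with zero mean. -/
def zeroMean : Submodule ℝ 𝓢(Plane, ℝ) where
  carrier := {f | ∫ v, f v = 0}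
  zero_mem' := by simp
  add_mem' {f g} hf hg := by
    have : ∫ v, (f + g) v = (∫ v, f v) + ∫ v, g v := by
      simpa using integral_add (f.integrable (μ := volume)) (g.integrable (μ := volume))
    simpa [hf.out, hg.out] using this
  smul_mem' c f hf := by
    have : ∫ v, (c • f) v = c * ∫ v, f v := by
      simpa using integral_const_mul c (f : Plane → ℝ)
    simpa [hf.out] using this

theorem fourierReal_zero_freq (f : zeroMean) : fourierReal f.1 0 = 0 := by
  have h : ∫ v, f.1 v = 0 := f.2
  change (𝓕 (f.1.postcompCLM Complex.ofRealCLM) : 𝓢(Plane, ℂ)) 0 = 0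
  rw [SchwartzMap.fourier_coe, Real.fourier_eq]
  simp [integral_complex_ofReal, h]

theorem memLp_weightNeg (f : zeroMean) :
    MemLp (fun κ => (weightNeg κ : ℂ) * fourierReal f.1 κ) 2 := by
  set g := fourierReal f.1 with hg
  obtain ⟨C, hC0, hC⟩ : ∃ C : ℝ, 0 ≤ C ∧ ∀ κ, ‖g κ‖ ≤ C * ‖κ‖ := by
    obtain ⟨C, hC0, hC⟩ := g.decay 0 1
    refine ⟨C, hC0.le, fun κ => ?_⟩
    have := Convex.norm_image_sub_le_of_norm_fderiv_le (𝕜 := ℝ) (f := g) (C := C) (s := univ)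
      (x := 0) (y := κ) (fun x _ => g.differentiableAt) (fun x _ => by
        have := hC x
        simpa using this) convex_univ (mem_univ _) (mem_univ _)
    simpa [hg, fourierReal_zero_freq f] using this
  have hm : AEStronglyMeasurable (fun κ => (weightNeg κ : ℂ) * g κ) volume :=
    ((Complex.measurable_ofReal.comp measurable_weightNeg).mul
      g.continuous.measurable).aestronglyMeasurable
  have h1 := (memLp_poly_mul g).norm
  have h2 : MemLp (indicator (Metric.closedBall (0 : Plane) 1) (fun _ => 41 * C)) 2 volume :=
    memLp_indicator_const 2 measurableSet_closedBall _ (Or.inr measure_closedBall_lt_top.ne)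
  refine (h1.add h2).mono hm ?_
  filter_upwards with κ
  rw [Pi.add_apply, norm_mul, norm_mul, Complex.norm_real, Complex.norm_real, Real.norm_eq_abs,
    Real.norm_eq_abs, Real.norm_eq_abs, abs_of_nonneg (weightNeg_nonneg κ)]
  have hpi := Real.pi_gt_three
  have hpi' := Real.pi_lt_d2
  have hw := weightNeg_le κ
  have hw0 := weightNeg_nonneg κ
  rw [abs_of_nonneg (by positivity : 0 ≤ 1 + waveNumber κ ^ 2)]
  by_cases hk : κ ∈ Metric.closedBall (0 : Plane) 1
  · rw [indicator_of_mem hk]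
    have hk' : ‖κ‖ ≤ 1 := by simpa using hk
    have hkey : weightNeg κ * ‖g κ‖ ≤ 41 * C := by
      rcases eq_or_ne κ 0 with rfl | hne
      · have := hC 0
        simp only [norm_zero, mul_zero] at this
        have h0 : ‖g 0‖ = 0 := le_antisymm this (norm_nonneg _)
        rw [h0]
        simpa using hC0
      · have hpos : 0 < ‖κ‖ := norm_pos_iff.mpr hne
        calc weightNeg κ * ‖g κ‖
            ≤ ((1 + waveNumber κ ^ 2) * (waveNumber κ)⁻¹) * (C * ‖κ‖) := by
              gcongr
              · exact mul_nonneg (by positivity) (inv_nonneg.mpr (waveNumber_nonneg κ))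
              · exact hC κ
          _ = (1 + (2 * Real.pi * ‖κ‖) ^ 2) * C * (2 * Real.pi)⁻¹ := by
              unfold waveNumber
              field_simp
          _ ≤ 41 * C * 1 := by
              have h3 : (2 * Real.pi * ‖κ‖) ^ 2 ≤ 40 := by
                have : 2 * Real.pi * ‖κ‖ ≤ 2 * 3.15 * 1 := by gcongr
                have h0 : 0 ≤ 2 * Real.pi * ‖κ‖ := by positivity
                nlinarith
              have h4 : (2 * Real.pi)⁻¹ ≤ 1 := inv_le_one_of_one_le₀ (by linarith)
              gcongr
              linarith
          _ = 41 * C := mul_one _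
    have hn : 0 ≤ (1 + waveNumber κ ^ 2) * ‖g κ‖ := by positivity
    rw [abs_of_nonneg (by positivity)]
    linarith
  · rw [indicator_of_notMem hk, add_zero, abs_of_nonneg (by positivity)]
    have hk' : 1 < ‖κ‖ := by simpa using hk
    gcongr
    refine hw.trans (mul_le_of_le_one_right (by positivity) (inv_le_one_of_one_le₀ ?_))
    unfold waveNumber
    nlinarith

/-- The isometry `f ↦ (1 + |k|²)^{-1/4} |k| f̂` of the Schwartz class, equipped with the norm
`‖·‖_{⋆,1/2}`, into `L²`. -/
def embedPos : 𝓢(Plane, ℝ) →ₗ[ℝ] Lp ℂ 2 (volume : Measure Plane) where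
  toFun f := (memLp_weightPos f).toLp
  map_add' f g := by
    rw [← MemLp.toLp_add]
    congr 1
    ext κ
    simp [mul_add]
  map_smul' c f := by
    rw [RingHom.id_apply, ← MemLp.toLp_const_smul]
    congr 1
    ext κ
    simp
    ring

/-- The isometry `f ↦ (1 + |k|²)^{1/4} |k|⁻¹ f̂` of the Schwartz functions with zero mean, equipped
with the norm `‖·‖_{⋆,-1/2}`, into `L²`. -/
def embedNeg : zeroMean →ₗ[ℝ] Lp ℂ 2 (volume : Measure Plane) where
  toFun f := (memLp_weightNeg f).toLp
  map_add' f g := by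
    rw [← MemLp.toLp_add]
    congr 1
    ext κ
    simp [mul_add]
  map_smul' c f := by
    rw [RingHom.id_apply, ← MemLp.toLp_const_smul]
    congr 1
    ext κ
    simp
    ring

/-- `H_⋆^{1/2}(ℝ²)`: the completion of the Schwartz class in the norm
`‖f‖² = ∫ (1 + |k|²)^{-1/2} |k|² |f̂|² dk`, realised as the closure of its isometric image
in `L²`. -/
def HPos : Submodule ℝ (Lp ℂ 2 (volume : Measure Plane)) :=
  (LinearMap.range embedPos).topologicalClosure

/-- `H_⋆^{-1/2}(ℝ²)`: the completion of the Schwartz functions with zero mean in the norm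
`‖f‖² = ∫ (1 + |k|²)^{1/2} |k|⁻² |f̂|² dk`, realised as the closure of its isometric image
in `L²`. -/
def HNeg : Submodule ℝ (Lp ℂ 2 (volume : Measure Plane)) :=
  (LinearMap.range embedNeg).topologicalClosure

/-- The canonical map of the Schwartz class into `H_⋆^{1/2}(ℝ²)`. -/
def toHPos : 𝓢(Plane, ℝ) →ₗ[ℝ] HPos :=
  embedPos.codRestrict HPos fun f =>
    Submodule.le_topologicalClosure _ (LinearMap.mem_range_self embedPos f)

/-- The canonical map of the Schwartz functions with zero mean into `H_⋆^{-1/2}(ℝ²)`. -/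
def toHNeg : zeroMean →ₗ[ℝ] HNeg :=
  embedNeg.codRestrict HNeg fun f =>
    Submodule.le_topologicalClosure _ (LinearMap.mem_range_self embedNeg f)

instance : CompleteSpace HPos := by
  unfold HPos
  infer_instance

instance : CompleteSpace HNeg := by
  unfold HNeg
  infer_instance

/-- The pairing `∫ ξ Φ dx dz` of `ξ ∈ H_⋆^{-1/2}(ℝ²)` and `Φ ∈ H_⋆^{1/2}(ℝ²)`: the continuous
extension of the integral from Schwartz functions (see `pairing_toHNeg_toHPos`), which in terms of
Fourier transforms is the real inner product of `L²`, because the two weights are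
reciprocal. -/
def pairing (ξ : HNeg) (Φ : HPos) : ℝ :=
  inner ℝ (ξ : Lp ℂ 2 (volume : Measure Plane)) (Φ : Lp ℂ 2 (volume : Measure Plane))

theorem weightNeg_mul_weightPos {κ : Plane} (h : κ ≠ 0) : weightNeg κ * weightPos κ = 1 := by
  have hw : 0 < waveNumber κ := by
    have := norm_pos_iff.mpr h
    unfold waveNumber
    positivity
  have h1 : (1 + waveNumber κ ^ 2) ^ (1 / 4 : ℝ) * (1 + waveNumber κ ^ 2) ^ (-(1 / 4) : ℝ) = 1 := by
    rw [← Real.rpow_add (by positivity)]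
    norm_num
  unfold weightNeg weightPos
  calc _ = ((1 + waveNumber κ ^ 2) ^ (1 / 4 : ℝ) * (1 + waveNumber κ ^ 2) ^ (-(1 / 4) : ℝ))
      * ((waveNumber κ)⁻¹ * waveNumber κ) := by ring
    _ = 1 := by rw [h1, inv_mul_cancel₀ hw.ne', one_mul]

theorem pairing_toHNeg_toHPos (ξ : zeroMean) (Φ : 𝓢(Plane, ℝ)) :
    pairing (toHNeg ξ) (toHPos Φ) = ∫ v, ξ.1 v * Φ v := by
  have h0 : ∀ᵐ κ : Plane, κ ≠ 0 := by
    simp [ae_iff]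
  have h1 : pairing (toHNeg ξ) (toHPos Φ)
      = ∫ κ, (inner ℂ (fourierReal ξ.1 κ) (fourierReal Φ κ)).re := by
    change inner ℝ (memLp_weightNeg ξ).toLp (memLp_weightPos Φ).toLp = _
    rw [L2.inner_def]
    apply integral_congr_ae
    filter_upwards [(memLp_weightNeg ξ).coeFn_toLp, (memLp_weightPos Φ).coeFn_toLp, h0]
      with κ a b c
    rw [a, b, Complex.inner]
    have hw := weightNeg_mul_weightPos c
    simp only [RCLike.inner_apply, map_mul, Complex.conj_ofReal]
    calc _ = (((weightNeg κ * weightPos κ : ℝ) : ℂ) *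
          (fourierReal Φ κ * (starRingEnd ℂ) (fourierReal ξ.1 κ))).re := by
          congr 1
          push_cast
          ring
      _ = _ := by rw [hw, Complex.ofReal_one, one_mul]
  have h2 : Integrable (fun κ => inner ℂ (fourierReal ξ.1 κ) (fourierReal Φ κ)) := by
    have a := (fourierReal ξ.1).memLp 2 (volume : Measure Plane)
    have b := (fourierReal Φ).memLp 2 (volume : Measure Plane)
    have := L2.integrable_inner (𝕜 := ℂ) a.toLp b.toLp
    refine this.congr ?_
    filter_upwards [a.coeFn_toLp, b.coeFn_toLp] with κ h h'
    rw [h, h']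
  have h3 : ∫ κ, inner ℂ (fourierReal ξ.1 κ) (fourierReal Φ κ)
      = ∫ v, ((ξ.1 v * Φ v : ℝ) : ℂ) := by
    have := SchwartzMap.integral_inner_fourier_fourier (ξ.1.postcompCLM Complex.ofRealCLM)
      (Φ.postcompCLM Complex.ofRealCLM)
    refine this.trans (integral_congr_ae (.of_forall fun v => ?_))
    simp [mul_comm]
  rw [h1]
  have h4 := integral_re (𝕜 := ℂ) h2
  rw [show (∫ κ, (inner ℂ (fourierReal ξ.1 κ) (fourierReal Φ κ)).re)
    = (∫ κ, inner ℂ (fourierReal ξ.1 κ) (fourierReal Φ κ)).re from h4, h3,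
    integral_complex_ofReal, Complex.ofReal_re]

/-! ### The space `H_⋆^1(Σ)` and the trace at `y = 1` -/

instance : (volume : Measure Space).IsAddHaarMeasure := by
  rw [Measure.volume_eq_prod]
  infer_instance

theorem memLp_grad (f : 𝓢(Space, ℝ)) :
    MemLp (fun p => !₂[(∂_{dirX} f) p, (∂_{dirZ} f) p, (∂_{dirY} f) p]) 2 slabMeasure := by
  rw [memLp_piLp_iff]
  intro i
  have h : ∀ g : 𝓢(Space, ℝ), MemLp (g : Space → ℝ) 2 slabMeasure := fun g =>
    (g.memLp 2 volume).restrict slab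
  fin_cases i
  · exact h _
  · exact h _
  · exact h _

/-- The gradient `(u_x, u_z, u_y)` on the slab of a Schwartz function, as an element of `L²(Σ)³`.
The norm of the gradient is the norm `‖u‖_⋆`. -/
def gradL2 : 𝓢(Space, ℝ) →ₗ[ℝ] Lp (EuclideanSpace ℝ (Fin 3)) 2 slabMeasure where
  toFun f := (memLp_grad f).toLp
  map_add' f g := by
    rw [← MemLp.toLp_add]
    congr 1
    ext p i
    fin_cases i <;> simp [LineDeriv.lineDerivOp_add]
  map_smul' c f := by
    rw [RingHom.id_apply, ← MemLp.toLp_const_smul]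
    congr 1
    ext p i
    fin_cases i <;> simp [LineDeriv.lineDerivOp_smul]

/-- `H_⋆^1(Σ)`: the completion in the norm `‖u‖_⋆² = ∫_Σ (u_x² + u_y² + u_z²)` of the class of
smooth, rapidly decreasing functions on the closed slab (the restrictions to it of the Schwartz
functions of the space), realised as the closure of its isometric image under the gradient
in `L²(Σ)³`. -/
def H1Star : Submodule ℝ (Lp (EuclideanSpace ℝ (Fin 3)) 2 slabMeasure) :=
  (LinearMap.range gradL2).topologicalClosure

/-- The canonical map of the Schwartz class into `H_⋆^1(Σ)`. -/
def toH1Star : 𝓢(Space, ℝ) →ₗ[ℝ] H1Star :=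
  gradL2.codRestrict H1Star fun f =>
    Submodule.le_topologicalClosure _ (LinearMap.mem_range_self gradL2 f)

/-- The derivatives `u_x`, `u_z` and `u_y` of an element `u` of `H_⋆^1(Σ)`. -/
def gradX (u : H1Star) : Space → ℝ := fun p => u.1 p 0

def gradZ (u : H1Star) : Space → ℝ := fun p => u.1 p 1

def gradY (u : H1Star) : Space → ℝ := fun p => u.1 p 2

theorem slice_hasTemperateGrowth (y : ℝ) :
    (fun v : Plane => ((v, y) : Space)).HasTemperateGrowth := by
  have h : (fun v : Plane => ((v, y) : Space))
      = fun v => ContinuousLinearMap.inl ℝ Plane ℝ v + ((0, y) : Space) := by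
    ext v <;> simp
  rw [h]
  fun_prop

theorem slice_antilipschitz (y : ℝ) :
    AntilipschitzWith 1 (fun v : Plane => ((v, y) : Space)) := by
  intro v w
  simp [Prod.edist_eq]

/-- The restriction `(x, z) ↦ u (x, y, z)` of a Schwartz function to a horizontal plane. -/
def slice (y : ℝ) : 𝓢(Space, ℝ) →ₗ[ℝ] 𝓢(Plane, ℝ) :=
  (SchwartzMap.compCLMOfAntilipschitz ℝ (slice_hasTemperateGrowth y)
    (slice_antilipschitz y)).toLinearMap

theorem slice_apply (y : ℝ) (f : 𝓢(Space, ℝ)) (v : Plane) : slice y f v = f (v, y) := rfl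

/-- The trace map `u ↦ u|_{y=1}` from `H_⋆^1(Σ)` to `H_⋆^{1/2}(ℝ²)`: the continuous extension
of the restriction of Schwartz functions (see `trace_toH1Star`). -/
def trace : H1Star →L[ℝ] HPos := (toHPos ∘ₗ slice 1).extendOfNorm toH1Star

theorem denseRange_toH1Star : DenseRange toH1Star := by
  rintro ⟨u, hu⟩
  rw [H1Star, ← SetLike.mem_coe, Submodule.topologicalClosure_coe] at hu
  rw [Topology.IsInducing.subtypeVal.closure_eq_preimage_closure_image, mem_preimage]
  convert hu using 2
  ext w
  simp only [mem_image, mem_range, exists_exists_eq_and, SetLike.mem_coe, LinearMap.mem_range]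
  rfl

theorem fourierReal_slice (y : ℝ) (g : 𝓢(Space, ℝ)) (κ : Plane) :
    fourierReal (slice y g) κ
      = ∫ v, Real.fourierChar (-(inner ℝ v κ)) • ((g (v, y) : ℝ) : ℂ) := by
  change (𝓕 ((slice y g).postcompCLM Complex.ofRealCLM) : 𝓢(Plane, ℂ)) κ = _
  rw [SchwartzMap.fourier_coe, Real.fourier_eq]
  rfl

theorem slice_bound (g : 𝓢(Space, ℝ)) :
    ∃ b : Plane → ℝ, Integrable b ∧ ∀ v y, ‖g (v, y)‖ ≤ b v := by
  set C := 2 ^ 3 * ((Finset.Iic (3, 0)).sup (schwartzSeminormFamily ℝ Space ℝ)) g with hC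
  refine ⟨fun v => C * (1 + ‖v‖) ^ (-3 : ℝ), ?_, fun v y => ?_⟩
  · exact (integrable_one_add_norm (by simp; norm_num)).const_mul C
  · have h := SchwartzMap.one_add_le_sup_seminorm_apply (𝕜 := ℝ) (m := (3, 0)) (k := 3) (n := 0)
      le_rfl le_rfl g (v, y)
    rw [norm_iteratedFDeriv_zero] at h
    have h1 : ‖v‖ ≤ ‖((v, y) : Space)‖ := norm_fst_le ((v, y) : Space)
    have h2 : (1 + ‖v‖) ^ 3 * ‖g (v, y)‖ ≤ C := le_trans (by gcongr) h
    change _ ≤ C * (1 + ‖v‖) ^ (-3 : ℝ)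
    rw [Real.rpow_neg (by positivity), ← div_eq_mul_inv, le_div_iff₀ (by positivity)]
    have h3 : (1 + ‖v‖) ^ (3 : ℝ) = (1 + ‖v‖) ^ 3 := by
      exact_mod_cast Real.rpow_natCast (1 + ‖v‖) 3
    rw [h3, mul_comm]
    exact h2

theorem continuous_fourierReal_slice (g : 𝓢(Space, ℝ)) :
    Continuous (fun q : Plane × ℝ => fourierReal (slice q.2 g) q.1) := by
  obtain ⟨b, hb, hgb⟩ := slice_bound g
  simp_rw [fourierReal_slice]
  refine continuous_of_dominated (bound := b) (fun q => ?_) (fun q => ?_) hb ?_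
  · refine Continuous.aestronglyMeasurable ?_
    have := g.continuous
    fun_prop
  · filter_upwards with v
    rw [Circle.norm_smul, Complex.norm_real]
    exact hgb v q.2
  · filter_upwards with v
    have := g.continuous
    fun_prop

theorem hasDerivAt_fourierReal_slice (g : 𝓢(Space, ℝ)) (κ : Plane) (y : ℝ) :
    HasDerivAt (fun t => fourierReal (slice t g) κ) (fourierReal (slice y (∂_{dirY} g)) κ) y := by
  obtain ⟨b, hb, hgb⟩ := slice_bound (∂_{dirY} g)
  simp_rw [fourierReal_slice]
  refine (hasDerivAt_integral_of_dominated_loc_of_deriv_le (𝕜 := ℝ) (μ := (volume : Measure Plane))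
    (F := fun t v => Real.fourierChar (-(inner ℝ v κ)) • ((g (v, t) : ℝ) : ℂ))
    (F' := fun t v => Real.fourierChar (-(inner ℝ v κ)) • (((∂_{dirY} g) (v, t) : ℝ) : ℂ))
    (bound := b) (s := univ)
    Filter.univ_mem ?_ ?_ ?_ ?_ hb ?_).2
  · filter_upwards with t
    refine Continuous.aestronglyMeasurable ?_
    have := g.continuous
    fun_prop
  · obtain ⟨b', hb', hgb'⟩ := slice_bound g
    refine hb'.mono' ?_ (.of_forall fun v => ?_)
    · refine Continuous.aestronglyMeasurable ?_
      have := g.continuous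
      fun_prop
    · rw [Circle.norm_smul, Complex.norm_real]
      exact hgb' v y
  · refine Continuous.aestronglyMeasurable ?_
    have := (∂_{dirY} g).continuous
    fun_prop
  · filter_upwards with v t _
    rw [Circle.norm_smul, Complex.norm_real]
    exact hgb v t
  · filter_upwards with v t _
    have h1 : HasDerivAt (fun s : ℝ => ((v, s) : Space)) dirY t :=
      (hasDerivAt_const t v).prodMk (hasDerivAt_id t)
    have h2 := (g.hasFDerivAt (v, t)).comp_hasDerivAt t h1
    have h3 : HasDerivAt (fun s => ((g (v, s) : ℝ) : ℂ)) (((∂_{dirY} g) (v, t) : ℝ) : ℂ) t := by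
      rw [SchwartzMap.lineDerivOp_apply_eq_fderiv]
      exact h2.ofReal_comp
    exact h3.const_smul _

theorem lintegral_fourierReal_sq (f : 𝓢(Plane, ℝ)) :
    ∫⁻ κ, ENNReal.ofReal (‖fourierReal f κ‖ ^ 2) = ∫⁻ v, ENNReal.ofReal (f v ^ 2) := by
  have hi : ∀ {E : Type} [NormedAddCommGroup E] [NormedSpace ℝ E] (g : 𝓢(Plane, E)),
      Integrable (fun v => ‖g v‖ ^ 2) := by
    intro E _ _ g
    exact (memLp_two_iff_integrable_sq_norm g.continuous.aestronglyMeasurable).1 (g.memLp 2 volume)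
  have h1 := hi (fourierReal f)
  have h2 := hi f
  simp only [Real.norm_eq_abs, sq_abs] at h2
  rw [← ofReal_integral_eq_lintegral_ofReal h1 (.of_forall fun _ => by positivity),
    ← ofReal_integral_eq_lintegral_ofReal h2 (.of_forall fun _ => by positivity)]
  congr 1
  have := SchwartzMap.integral_norm_sq_fourier (f.postcompCLM Complex.ofRealCLM)
  refine this.trans (integral_congr_ae (.of_forall fun v => ?_))
  simp

theorem waveNumber_sq_mul (y : ℝ) (f : 𝓢(Space, ℝ)) (κ : Plane) :
    waveNumber κ ^ 2 * ‖fourierReal (slice y f) κ‖ ^ 2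
      = ‖fourierReal (slice y (∂_{dirX} f)) κ‖ ^ 2
        + ‖fourierReal (slice y (∂_{dirZ} f)) κ‖ ^ 2 := by
  have key : ∀ e : Plane, fourierReal (slice y (∂_{((e, 0) : Space)} f)) κ
      = (2 * Real.pi * Complex.I) * (inner ℝ κ e : ℝ) * fourierReal (slice y f) κ := by
    intro e
    have h1 : (slice y (∂_{((e, 0) : Space)} f)).postcompCLM Complex.ofRealCLM
        = ∂_{e} ((slice y f).postcompCLM Complex.ofRealCLM) := by
      ext v
      rw [SchwartzMap.lineDerivOp_apply_eq_fderiv]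
      have ha : HasFDerivAt (fun w : Plane => ((w, y) : Space))
          (ContinuousLinearMap.inl ℝ Plane ℝ) v := hasFDerivAt_prodMk_left v y
      have hb := (f.hasFDerivAt (v, y)).comp v ha
      have hc := Complex.ofRealCLM.hasFDerivAt.comp v hb
      have hd : fderiv ℝ ((slice y f).postcompCLM Complex.ofRealCLM) v = _ := hc.fderiv
      rw [hd]
      simp [slice_apply, SchwartzMap.lineDerivOp_apply_eq_fderiv]
    change (𝓕 ((slice y (∂_{((e, 0) : Space)} f)).postcompCLM Complex.ofRealCLM) :
      𝓢(Plane, ℂ)) κ = _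
    rw [h1, SchwartzMap.fourier_lineDerivOp_eq]
    have ht : (fun x : Plane => (inner ℝ x e : ℝ)).HasTemperateGrowth := by fun_prop
    rw [_root_.smul_apply, SchwartzMap.smulLeftCLM_apply_apply ht]
    simp only [fourierReal, smul_eq_mul, LinearMap.coe_mk, AddHom.coe_mk, Complex.real_smul]
    ring
  have hx : fourierReal (slice y (∂_{dirX} f)) κ
      = (2 * Real.pi * Complex.I) * (κ 0 : ℝ) * fourierReal (slice y f) κ := by
    have := key planeX
    change fourierReal (slice y (∂_{dirX} f)) κ = _ at this
    rw [this]
    simp [planeX, EuclideanSpace.inner_single_right]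
  have hz : fourierReal (slice y (∂_{dirZ} f)) κ
      = (2 * Real.pi * Complex.I) * (κ 1 : ℝ) * fourierReal (slice y f) κ := by
    have := key planeZ
    change fourierReal (slice y (∂_{dirZ} f)) κ = _ at this
    rw [this]
    simp [planeZ, EuclideanSpace.inner_single_right]
  rw [hx, hz]
  simp only [norm_mul, Complex.norm_real, Complex.norm_I, waveNumber, mul_pow,
    EuclideanSpace.norm_sq_eq, Fin.sum_univ_two, Real.norm_eq_abs, sq_abs]
  simp
  ring

/-- The squared length of the gradient after a Fourier transform in the horizontal variables. -/
def fourierEnergy (f : 𝓢(Space, ℝ)) (κ : Plane) (y : ℝ) : ℝ :=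
  ‖fourierReal (slice y (∂_{dirX} f)) κ‖ ^ 2 + ‖fourierReal (slice y (∂_{dirZ} f)) κ‖ ^ 2
    + ‖fourierReal (slice y (∂_{dirY} f)) κ‖ ^ 2

theorem continuous_fourierEnergy (f : 𝓢(Space, ℝ)) :
    Continuous (fun q : Plane × ℝ => fourierEnergy f q.1 q.2) := by
  unfold fourierEnergy
  have h1 := continuous_fourierReal_slice (∂_{dirX} f)
  have h2 := continuous_fourierReal_slice (∂_{dirY} f)
  have h3 := continuous_fourierReal_slice (∂_{dirZ} f)
  exact ((h1.norm.pow 2).add (h3.norm.pow 2)).add (h2.norm.pow 2)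

theorem weightPos_sq_le (κ : Plane) : weightPos κ ^ 2 ≤ waveNumber κ := by
  have h := waveNumber_nonneg κ
  have e : weightPos κ ^ 2 = (1 + waveNumber κ ^ 2) ^ (-(1 / 2) : ℝ) * waveNumber κ ^ 2 := by
    unfold weightPos
    rw [mul_pow, ← Real.rpow_natCast, ← Real.rpow_mul (by positivity)]
    norm_num
  rw [e, Real.rpow_neg (by positivity), ← Real.sqrt_eq_rpow, inv_mul_eq_div,
    div_le_iff₀ (by positivity), sq]
  gcongr
  exact Real.le_sqrt_of_sq_le (by linarith)

theorem trace_ode {h h' : ℝ → ℂ} (hd : ∀ t, HasDerivAt h (h' t) t) (hc' : Continuous h')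
    {w ρ : ℝ} (w1 : w ^ 2 ≤ ρ) (w2 : w ^ 2 ≤ ρ ^ 2) :
    w ^ 2 * ‖h 1‖ ^ 2 ≤ ∫ y in (0 : ℝ)..1, 2 * (ρ ^ 2 * ‖h y‖ ^ 2 + ‖h' y‖ ^ 2) := by
  have hc : Continuous h := continuous_iff_continuousAt.2 fun t => (hd t).continuousAt
  have hd2 : ∀ t ∈ uIcc (0 : ℝ) 1, HasDerivAt (fun t => t * ‖h t‖ ^ 2)
      (1 * ‖h t‖ ^ 2 + t * (2 * inner ℝ (h t) (h' t))) t := fun t _ =>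
    (hasDerivAt_id t).mul (hd t).norm_sq
  have hcd : Continuous (fun t => 1 * ‖h t‖ ^ 2 + t * (2 * inner ℝ (h t) (h' t))) := by
    fun_prop
  have hint := intervalIntegral.integral_eq_sub_of_hasDerivAt hd2 (hcd.intervalIntegrable 0 1)
  have hval : ‖h 1‖ ^ 2 = ∫ t in (0 : ℝ)..1, (1 * ‖h t‖ ^ 2 + t * (2 * inner ℝ (h t) (h' t))) := by
    rw [hint]
    simp
  have hcE : Continuous (fun y => 2 * (ρ ^ 2 * ‖h y‖ ^ 2 + ‖h' y‖ ^ 2)) := by fun_prop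
  rw [hval, ← intervalIntegral.integral_const_mul]
  refine intervalIntegral.integral_mono_on zero_le_one
    ((continuous_const.mul hcd).intervalIntegrable _ _) (hcE.intervalIntegrable _ _) fun t ht => ?_
  have a1 : |inner ℝ (h t) (h' t)| ≤ ‖h t‖ * ‖h' t‖ := abs_real_inner_le_norm _ _
  generalize inner ℝ (h t) (h' t) = q at a1 ⊢
  have b1 := norm_nonneg (h t)
  have b2 := norm_nonneg (h' t)
  generalize ‖h t‖ = a at a1 b1 ⊢
  generalize ‖h' t‖ = b at a1 b2 ⊢
  have a2 : t * q ≤ a * b := by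
    calc t * q ≤ t * (a * b) := mul_le_mul_of_nonneg_left ((le_abs_self _).trans a1) ht.1
      _ ≤ 1 * (a * b) := by
          gcongr
          exact ht.2
      _ = a * b := one_mul _
  have a3 : w ^ 2 * (a * b) ≤ ρ * (a * b) := by gcongr
  have a4 : w ^ 2 * a ^ 2 ≤ ρ ^ 2 * a ^ 2 := by gcongr
  have a5 : w ^ 2 * (t * q) ≤ w ^ 2 * (a * b) := by gcongr
  nlinarith [sq_nonneg b, sq_nonneg (ρ * a - b)]

theorem trace_pointwise (f : 𝓢(Space, ℝ)) (κ : Plane) :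
    ‖(weightPos κ : ℂ) * fourierReal (slice 1 f) κ‖ ^ 2
      ≤ ∫ y in (0 : ℝ)..1, 2 * fourierEnergy f κ y := by
  have hc' : Continuous (fun t => fourierReal (slice t (∂_{dirY} f)) κ) := by
    have h0 := (continuous_fourierReal_slice (∂_{dirY} f)).comp
      (by fun_prop : Continuous fun t : ℝ => (κ, t))
    simpa only [Function.comp_def] using h0
  have w2 : weightPos κ ^ 2 ≤ waveNumber κ ^ 2 :=
    pow_le_pow_left₀ (weightPos_nonneg κ) (weightPos_le κ) 2
  have hd : ∀ t : ℝ, HasDerivAt (fun t : ℝ => fourierReal (slice t f) κ)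
      ((fun t : ℝ => fourierReal (slice t (∂_{dirY} f)) κ) t) t :=
    fun t => hasDerivAt_fourierReal_slice f κ t
  have h := trace_ode hd hc' (weightPos_sq_le κ) w2
  rw [norm_mul, mul_pow, Complex.norm_real, Real.norm_eq_abs, sq_abs]
  refine h.trans (le_of_eq ?_)
  congr 1
  ext y
  rw [fourierEnergy, waveNumber_sq_mul]

theorem lintegral_fourierEnergy (f : 𝓢(Space, ℝ)) (y : ℝ) :
    ∫⁻ κ, ENNReal.ofReal (fourierEnergy f κ y)
      = ∫⁻ v, ENNReal.ofReal ((∂_{dirX} f) (v, y) ^ 2 + (∂_{dirZ} f) (v, y) ^ 2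
          + (∂_{dirY} f) (v, y) ^ 2) := by
  have hm : ∀ g : 𝓢(Plane, ℝ), Measurable fun κ => ENNReal.ofReal (‖fourierReal g κ‖ ^ 2) :=
    fun g => ((fourierReal g).continuous.norm.pow 2).measurable.ennreal_ofReal
  have hm' : ∀ g : 𝓢(Plane, ℝ), Measurable fun v => ENNReal.ofReal (g v ^ 2) :=
    fun g => (g.continuous.pow 2).measurable.ennreal_ofReal
  unfold fourierEnergy
  simp_rw [← slice_apply]
  have e1 : ∀ κ, ENNReal.ofReal (‖fourierReal (slice y (∂_{dirX} f)) κ‖ ^ 2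
      + ‖fourierReal (slice y (∂_{dirZ} f)) κ‖ ^ 2 + ‖fourierReal (slice y (∂_{dirY} f)) κ‖ ^ 2)
      = ENNReal.ofReal (‖fourierReal (slice y (∂_{dirX} f)) κ‖ ^ 2)
      + ENNReal.ofReal (‖fourierReal (slice y (∂_{dirZ} f)) κ‖ ^ 2)
      + ENNReal.ofReal (‖fourierReal (slice y (∂_{dirY} f)) κ‖ ^ 2) := fun κ => by
    rw [ENNReal.ofReal_add (by positivity) (by positivity),
      ENNReal.ofReal_add (by positivity) (by positivity)]
  have e2 : ∀ v, ENNReal.ofReal (slice y (∂_{dirX} f) v ^ 2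
      + slice y (∂_{dirZ} f) v ^ 2 + slice y (∂_{dirY} f) v ^ 2)
      = ENNReal.ofReal (slice y (∂_{dirX} f) v ^ 2)
      + ENNReal.ofReal (slice y (∂_{dirZ} f) v ^ 2)
      + ENNReal.ofReal (slice y (∂_{dirY} f) v ^ 2) := fun v => by
    rw [ENNReal.ofReal_add (by positivity) (by positivity),
      ENNReal.ofReal_add (by positivity) (by positivity)]
  simp_rw [e1, e2]
  rw [lintegral_add_right _ (hm _), lintegral_add_right _ (hm _),
    lintegral_add_right _ (hm' _), lintegral_add_right _ (hm' _),
    lintegral_fourierReal_sq, lintegral_fourierReal_sq, lintegral_fourierReal_sq]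

theorem sq_norm_toLp {α E : Type*} [MeasurableSpace α] {μ : Measure α} [NormedAddCommGroup E]
    {f : α → E} (hf : MemLp f 2 μ) :
    ENNReal.ofReal (‖hf.toLp‖ ^ 2) = ∫⁻ a, ENNReal.ofReal (‖f a‖ ^ 2) ∂μ := by
  rw [Lp.norm_toLp, ENNReal.ofReal_pow (by positivity), ENNReal.ofReal_toReal hf.2.ne,
    ← ENNReal.rpow_natCast, eLpNorm_eq_lintegral_rpow_enorm_toReal (by norm_num) (by norm_num),
    ← ENNReal.rpow_mul]
  norm_num

theorem slabMeasure_eq : slabMeasure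
    = (volume : Measure Plane).prod ((volume : Measure ℝ).restrict (Ioo 0 1)) := by
  have h : slab = (univ : Set Plane) ×ˢ Ioo (0 : ℝ) 1 := by
    ext p
    simp [slab]
  rw [slabMeasure, h, Measure.volume_eq_prod, ← Measure.prod_restrict, Measure.restrict_univ]

theorem trace_pointwise_lintegral (f : 𝓢(Space, ℝ)) (κ : Plane) :
    ENNReal.ofReal (‖(weightPos κ : ℂ) * fourierReal (slice 1 f) κ‖ ^ 2)
      ≤ ∫⁻ y in Ioo (0 : ℝ) 1, 2 * ENNReal.ofReal (fourierEnergy f κ y) := by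
  have hE : Continuous (fun y => fourierEnergy f κ y) := by
    have h0 := (continuous_fourierEnergy f).comp (by fun_prop : Continuous fun t : ℝ => (κ, t))
    simpa only [Function.comp_def] using h0
  refine (ENNReal.ofReal_le_ofReal (trace_pointwise f κ)).trans (le_of_eq ?_)
  rw [intervalIntegral.integral_of_le zero_le_one, integral_Ioc_eq_integral_Ioo,
    ofReal_integral_eq_lintegral_ofReal]
  · refine lintegral_congr fun y => ?_
    rw [ENNReal.ofReal_mul (by norm_num)]
    norm_num
  · have hE2 : Continuous (fun y => 2 * fourierEnergy f κ y) := continuous_const.mul hE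
    exact (hE2.integrableOn_Icc (a := (0 : ℝ)) (b := 1)).mono_set Ioo_subset_Icc_self
  · refine .of_forall fun y => ?_
    change 0 ≤ 2 * fourierEnergy f κ y
    unfold fourierEnergy
    positivity

/-- The squared length of the gradient. -/
def gradSq (f : 𝓢(Space, ℝ)) (p : Space) : ℝ :=
  (∂_{dirX} f) p ^ 2 + (∂_{dirZ} f) p ^ 2 + (∂_{dirY} f) p ^ 2

theorem measurable_gradSq (f : 𝓢(Space, ℝ)) :
    Measurable (fun p => ENNReal.ofReal (gradSq f p)) := by
  have a := (∂_{dirX} f).continuous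
  have b := (∂_{dirZ} f).continuous
  have c := (∂_{dirY} f).continuous
  exact (((a.pow 2).add (b.pow 2)).add (c.pow 2)).measurable.ennreal_ofReal

theorem sq_norm_toH1Star (f : 𝓢(Space, ℝ)) :
    ENNReal.ofReal (‖toH1Star f‖ ^ 2) = ∫⁻ p, ENNReal.ofReal (gradSq f p) ∂slabMeasure := by
  refine (sq_norm_toLp (memLp_grad f)).trans (lintegral_congr fun p => ?_)
  rw [EuclideanSpace.norm_sq_eq]
  simp [Fin.sum_univ_three, gradSq]

theorem trace_lintegral_bound (f : 𝓢(Space, ℝ)) :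
    ∫⁻ κ, ENNReal.ofReal (‖(weightPos κ : ℂ) * fourierReal (slice 1 f) κ‖ ^ 2)
      ≤ 2 * ∫⁻ p, ENNReal.ofReal (gradSq f p) ∂slabMeasure := by
  calc ∫⁻ κ, ENNReal.ofReal (‖(weightPos κ : ℂ) * fourierReal (slice 1 f) κ‖ ^ 2)
      ≤ ∫⁻ κ, ∫⁻ y in Ioo (0 : ℝ) 1, 2 * ENNReal.ofReal (fourierEnergy f κ y) :=
        lintegral_mono (trace_pointwise_lintegral f)
    _ = ∫⁻ y in Ioo (0 : ℝ) 1, ∫⁻ κ, 2 * ENNReal.ofReal (fourierEnergy f κ y) := by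
        have hm := ((continuous_fourierEnergy f).measurable.ennreal_ofReal.const_mul 2)
        exact lintegral_lintegral_swap hm.aemeasurable
    _ = ∫⁻ y in Ioo (0 : ℝ) 1, 2 * ∫⁻ v, ENNReal.ofReal (gradSq f (v, y)) := by
        refine lintegral_congr fun y => ?_
        rw [lintegral_const_mul' _ _ (by norm_num), lintegral_fourierEnergy]
        rfl
    _ = 2 * ∫⁻ y in Ioo (0 : ℝ) 1, ∫⁻ v, ENNReal.ofReal (gradSq f (v, y)) :=
        lintegral_const_mul' _ _ (by norm_num)
    _ = 2 * ∫⁻ p, ENNReal.ofReal (gradSq f p) ∂slabMeasure := by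
        rw [slabMeasure_eq, lintegral_prod_symm' _ (measurable_gradSq f)]

theorem trace_bound (f : 𝓢(Space, ℝ)) :
    ‖toHPos (slice 1 f)‖ ≤ Real.sqrt 2 * ‖toH1Star f‖ := by
  have h1 : ENNReal.ofReal (‖toHPos (slice 1 f)‖ ^ 2)
      = ∫⁻ κ, ENNReal.ofReal (‖(weightPos κ : ℂ) * fourierReal (slice 1 f) κ‖ ^ 2) :=
    sq_norm_toLp (memLp_weightPos (slice 1 f))
  have h3 : ENNReal.ofReal (‖toHPos (slice 1 f)‖ ^ 2)
      ≤ ENNReal.ofReal (2 * ‖toH1Star f‖ ^ 2) := by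
    rw [h1, ENNReal.ofReal_mul (by norm_num), sq_norm_toH1Star]
    simpa using trace_lintegral_bound f
  have h4 : ‖toHPos (slice 1 f)‖ ^ 2 ≤ 2 * ‖toH1Star f‖ ^ 2 :=
    (ENNReal.ofReal_le_ofReal_iff (by positivity)).1 h3
  refine abs_le_of_sq_le_sq' ?_ (by positivity) |>.2
  rw [mul_pow, Real.sq_sqrt (by norm_num)]
  exact h4

theorem trace_toH1Star (f : 𝓢(Space, ℝ)) : trace (toH1Star f) = toHPos (slice 1 f) :=
  LinearMap.extendOfNorm_eq denseRange_toH1Star ⟨Real.sqrt 2, trace_bound⟩ f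

/-! ### Weak solutions and the two operators -/

/-- `F₁ = -η u_x + y η_x u_y`. -/
def F₁ (η : W1inf) (u : H1Star) (p : Space) : ℝ :=
  -(surf η p.1 * gradX u p) + p.2 * surfX η p.1 * gradY u p

/-- `F₂ = -η u_z + y η_z u_y`. -/
def F₂ (η : W1inf) (u : H1Star) (p : Space) : ℝ :=
  -(surf η p.1 * gradZ u p) + p.2 * surfZ η p.1 * gradY u p

/-- `F₃ = η u_y / (1 + η) + y η_x u_x + y η_z u_z
      - y² η_x² u_y / (1 + η) - y² η_z² u_y / (1 + η)`. -/
def F₃ (η : W1inf) (u : H1Star) (p : Space) : ℝ :=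
  surf η p.1 * gradY u p / (1 + surf η p.1) + p.2 * surfX η p.1 * gradX u p + p.2 * surfZ η p.1 * gradZ u p
    - p.2 ^ 2 / (1 + surf η p.1) * surfX η p.1 ^ 2 * gradY u p
    - p.2 ^ 2 / (1 + surf η p.1) * surfZ η p.1 ^ 2 * gradY u p

/-- `u` is a weak solution of the flattened boundary-value problem
`u_xx + u_yy + u_zz = ∂_x F₁ + ∂_z F₂ + ∂_y F₃` for `0 < y < 1`, `u_y = F₃ + ξ` at `y = 1`,
`u_y = 0` at `y = 0`. -/
def IsWeakSolution (η : W1inf) (ξ : HNeg) (u : H1Star) : Prop :=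
  ∀ w : H1Star,
    ∫ p, (gradX u p * gradX w p + gradY u p * gradY w p + gradZ u p * gradZ w p) ∂slabMeasure
      = ∫ p, (F₁ η u p * gradX w p + F₂ η u p * gradZ w p + F₃ η u p * gradY w p) ∂slabMeasure
        + pairing ξ (trace w)

/-- `N` is the Neumann-Dirichlet operator for `η`: for every `ξ` the boundary-value problem has a
unique weak solution `u`, and `N ξ = u|_{y=1}`. -/
def IsNeumannDirichlet (η : W1inf) (N : HNeg →L[ℝ] HPos) : Prop :=
  ∀ ξ : HNeg, (∃! u : H1Star, IsWeakSolution η ξ u) ∧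
    ∀ u : H1Star, IsWeakSolution η ξ u → N ξ = trace u

open Classical in
/-- The Neumann-Dirichlet operator `N(η)` (and `0` for those `η` for which it is not defined). -/
def neumannDirichlet (η : W1inf) : HNeg →L[ℝ] HPos :=
  if h : ∃ N, IsNeumannDirichlet η N then h.choose else 0

/-- The Dirichlet-Neumann operator `G(η) = N(η)⁻¹` (and `0` for those `η` for which `N(η)` has no
bounded inverse). -/
def dirichletNeumann (η : W1inf) : HPos →L[ℝ] HNeg := (neumannDirichlet η).inverse

end WaterWaves

end

noncomputable section

namespace WaterWaves

/-! ### The coefficient matrix of the flattened problem as an operator on `L²(Σ)³` -/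

/-! The flattened problem is a divergence-form equation: moving the `F` terms to the left turns the
weak formulation into `⟨A(η)∇u, ∇w⟩ = ∫ ξ w|_{y=1}`, where `A(η)` is multiplication by a symmetric 3
× 3 matrix. This matrix comes from the change of variable `Y = (1 + η) y`, so its quadratic form is
the Jacobian `1 + η` times the squared length of the physical gradient. It is therefore bounded
below, here by `1/8`, as long as `‖η‖ < 1/2`. The operator `A(η)` is a polynomial in multiplications
by `η`, `y η_x`, `y η_z` and `(1 + η)⁻¹`, hence analytic in `η` at `0`.

Since `H1Star` is a closed space of gradients, compressing `A(η)` to it gives a coercive operator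
`weakOp η`, invertible by Lax–Milgram. With `T` the trace and the two boundary spaces identified,
the Neumann–Dirichlet operator is `T (weakOp η)⁻¹ T*`. Inversion is analytic at units, and this
gives (i) and (ii).

For (iii), `T (weakOp η)⁻¹ T*` must itself be coercive. It inherits this from `(weakOp η)⁻¹` once
`T*` is bounded below, which is dual to extending boundary data to the slab with a norm estimate
(`exists_trace_eq`, `traceAdjoint_bounded_below`). The natural extension multiplies the Fourier
transform by `exp (-(1 - y) s)` with `s = |k|² (1 + |k|²)^{-1/2}`. It is replaced by `(1 - (1 - y) s
/ (n + 1)) ^ (n + 1)`, a polynomial in `y` and `s`, so that the extension of a test function is a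
finite sum of products of Schwartz functions. Inverting a bounded coercive operator then gives both
bounds for `G(η)`.

The duality of the boundary spaces is concrete: as the two weights are reciprocal, both spaces are
the same closed real subspace of `L²`, the closure of the Hermitian-symmetric test functions
supported away from the zero frequency (`HPos_eq_closure_testSpace`, `HNeg_eq_closure_testSpace`).
-/

/-- Square-integrable vector fields on the slab; the components are ordered as `(x, z, y)`. -/
abbrev VectorField : Type := Lp (EuclideanSpace ℝ (Fin 3)) 2 slabMeasure

/-- Multiplication of vector fields by bounded functions. -/
def mulOp : Lp ℝ ∞ slabMeasure →L[ℝ] VectorField →L[ℝ] VectorField :=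
  (ContinuousLinearMap.lsmul ℝ ℝ).holderL slabMeasure ∞ 2 2

theorem coeFn_mulOp (a : Lp ℝ ∞ slabMeasure) (u : VectorField) :
    mulOp a u =ᵐ[slabMeasure] fun p => a p • u p :=
  ContinuousLinearMap.coeFn_holder _ a u

theorem norm_mulOp_le (a : Lp ℝ ∞ slabMeasure) : ‖mulOp a‖ ≤ ‖a‖ := by
  refine ContinuousLinearMap.opNorm_le_bound _ (norm_nonneg _) fun u => ?_
  refine (ContinuousLinearMap.norm_holder_apply_apply_le _ a u).trans ?_
  have h : ‖(ContinuousLinearMap.lsmul ℝ ℝ : ℝ →L[ℝ] EuclideanSpace ℝ (Fin 3) →L[ℝ] _)‖ ≤ 1 :=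
    ContinuousLinearMap.opNorm_lsmul_le
  calc _ ≤ 1 * ‖a‖ * ‖u‖ := by gcongr
    _ = ‖a‖ * ‖u‖ := by rw [one_mul]

theorem measurePreserving_fst_slab :
    MeasurePreserving (Prod.fst : Space → Plane) slabMeasure volume := by
  rw [slabMeasure_eq]
  have : IsProbabilityMeasure ((volume : Measure ℝ).restrict (Ioo 0 1)) := ⟨by simp⟩
  exact measurePreserving_fst

/-- A bounded function of `(x, z)` as a function on the slab. -/
def liftPlane : Lp ℝ ∞ (volume : Measure Plane) →L[ℝ] Lp ℝ ∞ slabMeasure :=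
  (Lp.compMeasurePreservingₗᵢ ℝ Prod.fst measurePreserving_fst_slab).toContinuousLinearMap

theorem coeFn_liftPlane (a : Lp ℝ ∞ (volume : Measure Plane)) :
    liftPlane a =ᵐ[slabMeasure] fun p => a p.1 :=
  Lp.coeFn_compMeasurePreserving a measurePreserving_fst_slab

theorem norm_liftPlane (a : Lp ℝ ∞ (volume : Measure Plane)) : ‖liftPlane a‖ = ‖a‖ :=
  Lp.norm_compMeasurePreserving a measurePreserving_fst_slab

theorem ae_slab : ∀ᵐ p ∂slabMeasure, 0 < p.2 ∧ p.2 < 1 := by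
  have h : MeasurableSet slab :=
    (measurableSet_lt measurable_const measurable_snd).inter
      (measurableSet_lt measurable_snd measurable_const)
  exact ae_restrict_mem h

theorem memLp_height : MemLp (fun p : Space => p.2) ∞ slabMeasure := by
  refine memLp_top_of_bound measurable_snd.aestronglyMeasurable 1 ?_
  filter_upwards [ae_slab] with p hp
  rw [Real.norm_eq_abs, abs_of_pos hp.1]
  exact hp.2.le

/-- Multiplication of vector fields by the vertical coordinate `y`. -/
def heightOp : VectorField →L[ℝ] VectorField := mulOp memLp_height.toLp

/-- The operator which moves component `j` of a vector field to position `i`. -/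
def unitOp (i j : Fin 3) : VectorField →L[ℝ] VectorField :=
  ((EuclideanSpace.proj j : EuclideanSpace ℝ (Fin 3) →L[ℝ] ℝ).smulRight
    (EuclideanSpace.single i (1 : ℝ))).compLpL 2 slabMeasure

theorem coeFn_unitOp (i j : Fin 3) (u : VectorField) :
    unitOp i j u =ᵐ[slabMeasure] fun p => u p j • EuclideanSpace.single i (1 : ℝ) :=
  ContinuousLinearMap.coeFn_compLpL _ u

/-- Multiplication of vector fields by `η`. -/
def surfOp : W1inf →L[ℝ] VectorField →L[ℝ] VectorField :=
  mulOp ∘L liftPlane ∘L ContinuousLinearMap.fst ℝ _ _ ∘L W1inf.subtypeL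

/-- Multiplication of vector fields by `y η_x`. -/
def surfXOp : W1inf →L[ℝ] VectorField →L[ℝ] VectorField :=
  (ContinuousLinearMap.compL ℝ VectorField VectorField VectorField heightOp) ∘L mulOp ∘L liftPlane
    ∘L ContinuousLinearMap.fst ℝ _ _ ∘L ContinuousLinearMap.snd ℝ _ _ ∘L W1inf.subtypeL

/-- Multiplication of vector fields by `y η_z`. -/
def surfZOp : W1inf →L[ℝ] VectorField →L[ℝ] VectorField :=
  (ContinuousLinearMap.compL ℝ VectorField VectorField VectorField heightOp) ∘L mulOp ∘L liftPlane
    ∘L ContinuousLinearMap.snd ℝ _ _ ∘L ContinuousLinearMap.snd ℝ _ _ ∘L W1inf.subtypeL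

theorem coeFn_surfOp (η : W1inf) (u : VectorField) :
    surfOp η u =ᵐ[slabMeasure] fun p => surf η p.1 • u p := by
  filter_upwards [coeFn_mulOp (liftPlane η.1.1) u, coeFn_liftPlane η.1.1] with p h1 h2
  rw [h2] at h1
  exact h1

theorem coeFn_heightOp_mulOp (a : Lp ℝ ∞ (volume : Measure Plane)) (u : VectorField) :
    heightOp (mulOp (liftPlane a) u) =ᵐ[slabMeasure] fun p => (p.2 * a p.1) • u p := by
  filter_upwards [coeFn_mulOp (liftPlane a) u, coeFn_liftPlane a,
    coeFn_mulOp memLp_height.toLp (mulOp (liftPlane a) u), memLp_height.coeFn_toLp]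
    with p h1 h2 h3 h4
  rw [heightOp, h3, h1, h2, h4, smul_smul]

theorem coeFn_surfXOp (η : W1inf) (u : VectorField) :
    surfXOp η u =ᵐ[slabMeasure] fun p => (p.2 * surfX η p.1) • u p :=
  coeFn_heightOp_mulOp η.1.2.1 u

theorem coeFn_surfZOp (η : W1inf) (u : VectorField) :
    surfZOp η u =ᵐ[slabMeasure] fun p => (p.2 * surfZ η p.1) • u p :=
  coeFn_heightOp_mulOp η.1.2.2 u

theorem norm_surfOp_le (η : W1inf) : ‖surfOp η‖ ≤ ‖η‖ :=
  (norm_mulOp_le _).trans ((norm_liftPlane _).le.trans (norm_fst_le η.1))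

theorem ae_abs_le_norm (a : Lp ℝ ∞ (volume : Measure Plane)) :
    ∀ᵐ p ∂slabMeasure, |a p.1| ≤ ‖a‖ := by
  have h : ∀ᵐ v : Plane, ‖a v‖ ≤ ‖a‖ := by
    have := ae_le_eLpNormEssSup (f := a) (μ := (volume : Measure Plane))
    filter_upwards [this] with v hv
    rw [Lp.norm_def, eLpNorm_exponent_top, ← toReal_enorm]
    exact ENNReal.toReal_mono (by rw [← eLpNorm_exponent_top]; exact Lp.eLpNorm_ne_top a) hv
  exact measurePreserving_fst_slab.quasiMeasurePreserving.ae h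

theorem ae_surf_bounds {η : W1inf} (hη : ‖η‖ < 1 / 2) : ∀ᵐ p ∂slabMeasure,
    |surf η p.1| ≤ 1 / 2 ∧ |surfX η p.1| ≤ 1 / 2 ∧ |surfZ η p.1| ≤ 1 / 2 := by
  have h1 : ‖η.1.1‖ ≤ ‖η‖ := norm_fst_le η.1
  have h2 : ‖η.1.2‖ ≤ ‖η‖ := norm_snd_le η.1
  have h3 : ‖η.1.2.1‖ ≤ ‖η.1.2‖ := norm_fst_le η.1.2
  have h4 : ‖η.1.2.2‖ ≤ ‖η.1.2‖ := norm_snd_le η.1.2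
  filter_upwards [ae_abs_le_norm η.1.1, ae_abs_le_norm η.1.2.1, ae_abs_le_norm η.1.2.2]
    with p k1 k2 k3
  exact ⟨by unfold surf; linarith, by unfold surfX; linarith, by unfold surfZ; linarith⟩

/-- Multiplication of vector fields by `(1 + η)⁻¹`. -/
def reciprocalOp (η : W1inf) : VectorField →L[ℝ] VectorField := Ring.inverse (1 + surfOp η)

/-- The inverse is taken in the operator algebra, where it is analytic; `‖η‖ < 1/2` makes `1 +
surfOp η` a unit by the Neumann series. Since applying `1 + η` to the result recovers `u` and `1 +
η` does not vanish, the inverse is almost everywhere division by `1 + η`. -/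
theorem coeFn_reciprocalOp {η : W1inf} (hη : ‖η‖ < 1 / 2) (u : VectorField) :
    reciprocalOp η u =ᵐ[slabMeasure] fun p => (1 + surf η p.1)⁻¹ • u p := by
  have hu : IsUnit (1 + surfOp η) := by
    have h := isUnit_one_sub_of_norm_lt_one (x := -surfOp η) (by
      rw [norm_neg]
      have := norm_surfOp_le η
      linarith)
    rwa [sub_neg_eq_add] at h
  have h1 : (1 + surfOp η) (reciprocalOp η u) = u := by
    have := Ring.mul_inverse_cancel _ hu
    exact congrArg (fun T : VectorField →L[ℝ] VectorField => T u) this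
  have h2 : reciprocalOp η u + surfOp η (reciprocalOp η u) = u := h1
  have h3 := Lp.coeFn_add (reciprocalOp η u) (surfOp η (reciprocalOp η u))
  rw [h2] at h3
  filter_upwards [h3, coeFn_surfOp η (reciprocalOp η u), ae_surf_bounds hη] with p k1 k2 k3
  have h4 : 1 + surf η p.1 ≠ 0 := by
    have := (abs_le.1 k3.1).1
    linarith
  rw [Pi.add_apply, k2] at k1
  rw [k1, show (reciprocalOp η u) p + surf η p.1 • (reciprocalOp η u) p
    = (1 + surf η p.1) • (reciprocalOp η u) p by rw [add_smul, one_smul], smul_smul,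
    inv_mul_cancel₀ h4, one_smul]

/-- The coefficient matrix of the flattened Laplace operator: it maps a gradient
`(u_x, u_z, u_y)` to `(u_x - F₁, u_z - F₂, u_y - F₃)`. -/
def coeffOp (η : W1inf) : VectorField →L[ℝ] VectorField :=
  1 + surfOp η * (unitOp 0 0 + unitOp 1 1) - surfXOp η * (unitOp 0 2 + unitOp 2 0)
    - surfZOp η * (unitOp 1 2 + unitOp 2 1)
    + (surfXOp η * surfXOp η + surfZOp η * surfZOp η - surfOp η) * reciprocalOp η * unitOp 2 2

/-- The three multiplication operators are continuous linear in `η`, and `(1 + η)⁻¹` is the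
inversion map, analytic at the unit `1`, composed with an affine map. Sums and products preserve
analyticity. -/
theorem analyticAt_coeffOp : AnalyticAt ℝ coeffOp 0 := by
  have h1 : AnalyticAt ℝ (fun η => surfOp η) 0 := surfOp.analyticAt 0
  have h2 : AnalyticAt ℝ (fun η => surfXOp η) 0 := surfXOp.analyticAt 0
  have h3 : AnalyticAt ℝ (fun η => surfZOp η) 0 := surfZOp.analyticAt 0
  have h4 : AnalyticAt ℝ reciprocalOp 0 := by
    have h5 : AnalyticAt ℝ (Ring.inverse : (VectorField →L[ℝ] VectorField) → _)
        (1 + surfOp 0) := by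
      rw [map_zero, add_zero]
      exact analyticAt_inverse (1 : (VectorField →L[ℝ] VectorField)ˣ)
    exact AnalyticAt.fun_comp (f := fun η => 1 + surfOp η) h5 (analyticAt_const.add h1)
  exact (((analyticAt_const.add (h1.mul analyticAt_const)).sub (h2.mul analyticAt_const)).sub
    (h3.mul analyticAt_const)).add
    (((((h2.mul h2).add (h3.mul h3)).sub h1).mul h4).mul analyticAt_const)

theorem coeFn_coeffOp {η : W1inf} (hη : ‖η‖ < 1 / 2) (u : VectorField) :
    ∀ᵐ p ∂slabMeasure,
      coeffOp η u p 0 = u p 0 + surf η p.1 * u p 0 - p.2 * surfX η p.1 * u p 2 ∧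
      coeffOp η u p 1 = u p 1 + surf η p.1 * u p 1 - p.2 * surfZ η p.1 * u p 2 ∧
      coeffOp η u p 2 = u p 2 - p.2 * surfX η p.1 * u p 0 - p.2 * surfZ η p.1 * u p 1
        + ((p.2 * surfX η p.1) ^ 2 + (p.2 * surfZ η p.1) ^ 2 - surf η p.1)
          * ((1 + surf η p.1)⁻¹ * u p 2) := by
  set r := reciprocalOp η (unitOp 2 2 u)
  have e : coeffOp η u = u + surfOp η (unitOp 0 0 u + unitOp 1 1 u)
      - surfXOp η (unitOp 0 2 u + unitOp 2 0 u) - surfZOp η (unitOp 1 2 u + unitOp 2 1 u)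
      + (surfXOp η (surfXOp η r) + surfZOp η (surfZOp η r) - surfOp η r) := rfl
  rw [e]
  filter_upwards [Lp.coeFn_add (u + surfOp η (unitOp 0 0 u + unitOp 1 1 u)
      - surfXOp η (unitOp 0 2 u + unitOp 2 0 u) - surfZOp η (unitOp 1 2 u + unitOp 2 1 u))
      (surfXOp η (surfXOp η r) + surfZOp η (surfZOp η r) - surfOp η r),
    Lp.coeFn_sub (u + surfOp η (unitOp 0 0 u + unitOp 1 1 u)
      - surfXOp η (unitOp 0 2 u + unitOp 2 0 u)) (surfZOp η (unitOp 1 2 u + unitOp 2 1 u)),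
    Lp.coeFn_sub (u + surfOp η (unitOp 0 0 u + unitOp 1 1 u))
      (surfXOp η (unitOp 0 2 u + unitOp 2 0 u)),
    Lp.coeFn_add u (surfOp η (unitOp 0 0 u + unitOp 1 1 u)),
    Lp.coeFn_sub (surfXOp η (surfXOp η r) + surfZOp η (surfZOp η r)) (surfOp η r),
    Lp.coeFn_add (surfXOp η (surfXOp η r)) (surfZOp η (surfZOp η r)),
    coeFn_surfOp η (unitOp 0 0 u + unitOp 1 1 u), coeFn_surfXOp η (unitOp 0 2 u + unitOp 2 0 u),
    coeFn_surfZOp η (unitOp 1 2 u + unitOp 2 1 u), coeFn_surfXOp η (surfXOp η r),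
    coeFn_surfZOp η (surfZOp η r), coeFn_surfXOp η r, coeFn_surfZOp η r, coeFn_surfOp η r,
    coeFn_reciprocalOp hη (unitOp 2 2 u), Lp.coeFn_add (unitOp 0 0 u) (unitOp 1 1 u),
    Lp.coeFn_add (unitOp 0 2 u) (unitOp 2 0 u), Lp.coeFn_add (unitOp 1 2 u) (unitOp 2 1 u),
    coeFn_unitOp 0 0 u, coeFn_unitOp 1 1 u, coeFn_unitOp 0 2 u, coeFn_unitOp 2 0 u,
    coeFn_unitOp 1 2 u, coeFn_unitOp 2 1 u, coeFn_unitOp 2 2 u]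
    with p a1 a2 a3 a4 a5 a6 a7 a8 a9 a10 a11 a12 a13 a14 a15 a16 a17 a18 a19 a20 a21 a22 a23 a24
      a25
  simp only [a1, a2, a3, a4, a5, a6, a7, a8, a9, a10, a11, a12, a13, a14, a16, a17, a18,
    a19, a20, a21, a22, a23, a24, Pi.add_apply, Pi.sub_apply]
  simp only [r, a15, a25]
  refine ⟨by simp, by simp, ?_⟩
  simp
  ring

/-- Pointwise `∇u · ∇w - A(η)∇u · ∇w` is the integrand built from the `F` terms. Starting from this
difference of two integrable products makes a separate integrability proof for the `F` terms
unnecessary. -/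
theorem inner_coeffOp {η : W1inf} (hη : ‖η‖ < 1 / 2) (u w : H1Star) :
    inner ℝ (coeffOp η u.1) w.1
      = ∫ p, (gradX u p * gradX w p + gradY u p * gradY w p + gradZ u p * gradZ w p) ∂slabMeasure
        - ∫ p, (F₁ η u p * gradX w p + F₂ η u p * gradZ w p + F₃ η u p * gradY w p)
          ∂slabMeasure := by
  have i1 := L2.integrable_inner (𝕜 := ℝ) u.1 w.1
  have i2 := L2.integrable_inner (𝕜 := ℝ) (coeffOp η u.1) w.1
  have e1 : (fun p => inner ℝ (u.1 p) (w.1 p)) =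
      fun p => gradX u p * gradX w p + gradY u p * gradY w p + gradZ u p * gradZ w p := by
    ext p
    simp only [PiLp.inner_apply, Fin.sum_univ_three, gradX, gradY, gradZ]
    simp
    ring
  have e2 : (fun p => inner ℝ (u.1 p) (w.1 p) - inner ℝ (coeffOp η u.1 p) (w.1 p))
      =ᵐ[slabMeasure]
      fun p => F₁ η u p * gradX w p + F₂ η u p * gradZ w p + F₃ η u p * gradY w p := by
    filter_upwards [coeFn_coeffOp hη u.1, ae_surf_bounds hη] with p hp hb
    have h4 : 1 + surf η p.1 ≠ 0 := by
      have := (abs_le.1 hb.1).1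
      linarith
    simp only [PiLp.inner_apply, Fin.sum_univ_three, hp.1, hp.2.1, hp.2.2, F₁, F₂, F₃, gradX,
      gradY, gradZ]
    simp
    field_simp
    ring
  rw [← e1, ← integral_congr_ae e2, integral_sub i1 i2, sub_sub_cancel, L2.inner_def]

/-- Here `h`, `s`, `t` stand for `η`, `y η_x`, `y η_z`. Completing squares writes the form as `(1 +
h)⁻¹` times `((1 + h) a - s c)² + ((1 + h) b - t c)² + c²`, the energy density of the problem before
flattening. The last square is split as `1/4 + 1/4 + 1/2`: the quarters absorb the cross terms with
`a` and `b`, the half controls `c` itself. -/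
theorem coeff_pointwise_lower {a b c h s t : ℝ} (hh : |h| ≤ 1 / 2) (hs : |s| ≤ 1 / 2)
    (ht : |t| ≤ 1 / 2) :
    1 / 8 * (a ^ 2 + b ^ 2 + c ^ 2) ≤ (a + h * a - s * c) * a + (b + h * b - t * c) * b
      + (c - s * a - t * b + (s ^ 2 + t ^ 2 - h) * ((1 + h)⁻¹ * c)) * c := by
  obtain ⟨h1, h2⟩ := abs_le.1 hh
  obtain ⟨s1, s2⟩ := abs_le.1 hs
  obtain ⟨t1, t2⟩ := abs_le.1 ht
  have hp : 0 < 1 + h := by linarith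
  have e : (a + h * a - s * c) * a + (b + h * b - t * c) * b
      + (c - s * a - t * b + (s ^ 2 + t ^ 2 - h) * ((1 + h)⁻¹ * c)) * c
      = (((1 + h) * a - s * c) ^ 2 + ((1 + h) * b - t * c) ^ 2 + c ^ 2) / (1 + h) := by
    field_simp
    ring
  rw [e, le_div_iff₀ hp]
  have k1 : s ^ 2 ≤ 1 / 4 := by nlinarith
  have k2 : t ^ 2 ≤ 1 / 4 := by nlinarith
  have key : ∀ x σ : ℝ, σ ^ 2 ≤ 1 / 4 →
      1 / 8 * ((1 + h) * x ^ 2) ≤ ((1 + h) * x - σ * c) ^ 2 + 1 / 4 * c ^ 2 := by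
    intro x σ hσ
    have a1 : σ ^ 2 * c ^ 2 ≤ 1 / 4 * c ^ 2 := by gcongr
    have a2 : (1 + h) * x ^ 2 * (1 / 2) ≤ (1 + h) * x ^ 2 * (1 + h) := by
      gcongr
      linarith
    -- This square gives `(X - Y)² ≥ X² / 2 - Y²` with `X = (1 + h) x` and `Y = σ c`.
    nlinarith [sq_nonneg ((1 + h) * x - 2 * (σ * c))]
  have k3 := key a s k1
  have k4 := key b t k2
  have k5 : 1 / 8 * ((1 + h) * c ^ 2) ≤ 1 / 2 * c ^ 2 := by nlinarith [sq_nonneg c]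
  linarith

theorem coeffOp_coercive {η : W1inf} (hη : ‖η‖ < 1 / 2) (u : VectorField) :
    1 / 8 * ‖u‖ ^ 2 ≤ inner ℝ (coeffOp η u) u := by
  have i1 := L2.integrable_inner (𝕜 := ℝ) u u
  have i2 := L2.integrable_inner (𝕜 := ℝ) (coeffOp η u) u
  rw [← real_inner_self_eq_norm_sq, L2.inner_def, L2.inner_def, ← integral_const_mul]
  refine integral_mono_ae (i1.const_mul _) i2 ?_
  filter_upwards [coeFn_coeffOp hη u, ae_surf_bounds hη, ae_slab] with p hp hb hy
  have hm : ∀ x : ℝ, |x| ≤ 1 / 2 → |p.2 * x| ≤ 1 / 2 := fun x hx => by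
    rw [abs_mul, abs_of_pos hy.1]
    have := abs_nonneg x
    nlinarith [hy.2]
  have key := coeff_pointwise_lower (a := u p 0) (b := u p 1) (c := u p 2) hb.1 (hm _ hb.2.1)
    (hm _ hb.2.2)
  simp only [PiLp.inner_apply, Fin.sum_univ_three, hp.1, hp.2.1, hp.2.2]
  simp only [RCLike.inner_apply, conj_trivial]
  linarith


/-! ### The two trace spaces coincide as subspaces of `L²` -/

/-- A smooth function of the frequency with compact support away from the origin which is the
Fourier transform of a real function. -/
structure IsHermitianTest (φ : Plane → ℂ) : Prop where
  contDiff : ContDiff ℝ (⊤ : ℕ∞) φ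
  compact : HasCompactSupport φ
  zero : φ =ᶠ[nhds 0] 0
  symm : ∀ κ, φ (-κ) = (starRingEnd ℂ) (φ κ)

/-- The multiplier may be singular at the origin, as the weights are, because `φ` vanishes on a
neighbourhood of it. -/
theorem IsHermitianTest.mul {φ : Plane → ℂ} (h : IsHermitianTest φ) {g : Plane → ℝ}
    (hg : ∀ κ, κ ≠ 0 → ContDiffAt ℝ (⊤ : ℕ∞) g κ) (he : ∀ κ, g (-κ) = g κ) :
    IsHermitianTest (fun κ => (g κ : ℂ) * φ κ) where
  contDiff := by
    rw [contDiff_iff_contDiffAt]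
    intro κ
    rcases eq_or_ne κ 0 with rfl | hκ
    · refine (contDiffAt_const (c := (0 : ℂ))).congr_of_eventuallyEq ?_
      filter_upwards [h.zero] with κ hκ
      rw [hκ, Pi.zero_apply, mul_zero]
    · exact (Complex.ofRealCLM.contDiff.contDiffAt.comp κ (hg κ hκ)).mul h.contDiff.contDiffAt
  compact := h.compact.mul_left
  zero := by
    filter_upwards [h.zero] with κ hκ
    rw [hκ, Pi.zero_apply, mul_zero]
  symm κ := by rw [he, h.symm, map_mul, Complex.conj_ofReal]

theorem fourierReal_neg (f : 𝓢(Plane, ℝ)) (κ : Plane) :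
    fourierReal f (-κ) = (starRingEnd ℂ) (fourierReal f κ) := by
  change (𝓕 (f.postcompCLM Complex.ofRealCLM) : 𝓢(Plane, ℂ)) (-κ)
    = (starRingEnd ℂ) ((𝓕 (f.postcompCLM Complex.ofRealCLM) : 𝓢(Plane, ℂ)) κ)
  rw [SchwartzMap.fourier_coe, Real.fourier_eq, Real.fourier_eq, ← integral_conj]
  refine integral_congr_ae (.of_forall fun v => ?_)
  simp [Circle.smul_def, ← Circle.coe_inv_eq_conj, AddChar.map_neg_eq_inv]

/-- A test function is the Fourier transform of a real Schwartz function. -/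
theorem IsHermitianTest.exists_fourierReal {φ : Plane → ℂ} (h : IsHermitianTest φ) :
    ∃ f : 𝓢(Plane, ℝ), ∀ κ, fourierReal f κ = φ κ := by
  set ψ : 𝓢(Plane, ℂ) := h.compact.toSchwartzMap h.contDiff with hψ
  have hψφ : ∀ κ, ψ κ = φ κ := fun κ => rfl
  set g : 𝓢(Plane, ℂ) := 𝓕⁻ ψ with hg
  -- Conjugation followed by the substitution `κ ↦ -κ` reproduces the inverse Fourier integral, by
  -- the Hermitian symmetry of `φ`.
  have hreal : ∀ v, (starRingEnd ℂ) (g v) = g v := by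
    intro v
    rw [hg, SchwartzMap.fourierInv_coe, Real.fourierInv_eq, ← integral_conj,
      ← integral_neg_eq_self]
    refine integral_congr_ae (.of_forall fun κ => ?_)
    simp [Circle.smul_def, ← Circle.coe_inv_eq_conj, AddChar.map_neg_eq_inv, hψφ, h.symm]
  refine ⟨g.postcompCLM Complex.reCLM, fun κ => ?_⟩
  have e : (g.postcompCLM Complex.reCLM).postcompCLM Complex.ofRealCLM = g := by
    ext v
    simpa using Complex.conj_eq_iff_re.1 (hreal v)
  change (𝓕 ((g.postcompCLM Complex.reCLM).postcompCLM Complex.ofRealCLM) : 𝓢(Plane, ℂ)) κ = _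
  rw [e, hg, FourierTransform.fourier_fourierInv_eq, hψφ]

/-- The classes of the test functions. -/
def testSpace : Submodule ℝ (Lp ℂ 2 (volume : Measure Plane)) where
  carrier := {F | ∃ φ, IsHermitianTest φ ∧ F =ᵐ[volume] φ}
  zero_mem' := ⟨0, ⟨contDiff_const, HasCompactSupport.zero, .rfl, by simp⟩, Lp.coeFn_zero _ _ _⟩
  add_mem' := by
    rintro F G ⟨φ, hφ, e⟩ ⟨ψ, hψ, e'⟩
    refine ⟨φ + ψ, ⟨hφ.contDiff.add hψ.contDiff, hφ.compact.add hψ.compact, ?_, ?_⟩,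
      (Lp.coeFn_add F G).trans (e.add e')⟩
    · simpa using hφ.zero.add hψ.zero
    · simp [hφ.symm, hψ.symm]
  smul_mem' := by
    rintro c F ⟨φ, hφ, e⟩
    refine ⟨c • φ, ⟨hφ.contDiff.const_smul c, ?_, ?_, ?_⟩, (Lp.coeFn_smul c F).trans (e.const_smul c)⟩
    · exact hφ.compact.smul_left (f := fun _ => c)
    · simpa using hφ.zero.const_smul c
    · simp [hφ.symm]

theorem IsHermitianTest.exists_mem_testSpace {φ : Plane → ℂ} (h : IsHermitianTest φ) :
    ∃ F ∈ testSpace, F =ᵐ[volume] φ := by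
  have hm : MemLp φ 2 := h.contDiff.continuous.memLp_of_hasCompactSupport h.compact
  exact ⟨hm.toLp, ⟨φ, h, hm.coeFn_toLp⟩, hm.coeFn_toLp⟩

theorem contDiffAt_waveNumber {κ : Plane} (h : κ ≠ 0) :
    ContDiffAt ℝ (⊤ : ℕ∞) waveNumber κ :=
  contDiffAt_const.mul (contDiffAt_norm ℝ h)

theorem waveNumber_pos {κ : Plane} (h : κ ≠ 0) : 0 < waveNumber κ := by
  have := norm_pos_iff.2 h
  have := Real.pi_pos
  unfold waveNumber
  positivity

theorem contDiffAt_weightPos {κ : Plane} (h : κ ≠ 0) :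
    ContDiffAt ℝ (⊤ : ℕ∞) weightPos κ := by
  have h1 := contDiffAt_waveNumber h
  have h2 : 1 + waveNumber κ ^ 2 ≠ 0 := by positivity
  exact ((contDiffAt_const.add (h1.pow 2)).rpow_const_of_ne h2).mul h1

theorem contDiffAt_weightNeg {κ : Plane} (h : κ ≠ 0) :
    ContDiffAt ℝ (⊤ : ℕ∞) weightNeg κ := by
  have h1 := contDiffAt_waveNumber h
  have h2 : 1 + waveNumber κ ^ 2 ≠ 0 := by positivity
  exact ((contDiffAt_const.add (h1.pow 2)).rpow_const_of_ne h2).mul (h1.inv (waveNumber_pos h).ne')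

theorem waveNumber_neg (κ : Plane) : waveNumber (-κ) = waveNumber κ := by
  simp [waveNumber]

theorem weightPos_neg (κ : Plane) : weightPos (-κ) = weightPos κ := by
  simp [weightPos, waveNumber_neg]

theorem weightNeg_neg (κ : Plane) : weightNeg (-κ) = weightNeg κ := by
  simp [weightNeg, waveNumber_neg]

theorem IsHermitianTest.weight_cancel {φ : Plane → ℂ} (h : IsHermitianTest φ) (κ : Plane) :
    (weightNeg κ : ℂ) * ((weightPos κ : ℂ) * φ κ) = φ κ := by
  rcases eq_or_ne κ 0 with rfl | hκ
  · rw [h.zero.eq_of_nhds]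
    simp
  · rw [← mul_assoc, ← Complex.ofReal_mul, weightNeg_mul_weightPos hκ, Complex.ofReal_one, one_mul]

/-- Every element of `testSpace` comes from a Schwartz function whose Fourier transform is a test
function. -/
theorem exists_embedPos_eq {F : Lp ℂ 2 (volume : Measure Plane)} (hF : F ∈ testSpace) :
    ∃ f : 𝓢(Plane, ℝ), IsHermitianTest (fourierReal f) ∧ embedPos f = F := by
  obtain ⟨φ, hφ, e⟩ := hF
  have h1 := hφ.mul (fun κ => contDiffAt_weightNeg) weightNeg_neg
  obtain ⟨f, hf⟩ := h1.exists_fourierReal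
  refine ⟨f, by rwa [show (fourierReal f : Plane → ℂ) = _ from funext hf], ?_⟩
  refine Lp.ext ((memLp_weightPos f).coeFn_toLp.trans (Filter.EventuallyEq.trans
    (.of_forall fun κ => ?_) e.symm))
  change (weightPos κ : ℂ) * fourierReal f κ = φ κ
  rw [hf, mul_left_comm, hφ.weight_cancel]

/-- Dividing by `weightNeg` is multiplying by `weightPos`. The zero mean is automatic: it says that
the Fourier transform vanishes at frequency `0`, and a test function vanishes near there. -/
theorem exists_embedNeg_eq {F : Lp ℂ 2 (volume : Measure Plane)} (hF : F ∈ testSpace) :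
    ∃ f : zeroMean, embedNeg f = F := by
  obtain ⟨φ, hφ, e⟩ := hF
  have h1 := hφ.mul (fun κ => contDiffAt_weightPos) weightPos_neg
  obtain ⟨f, hf⟩ := h1.exists_fourierReal
  have hmean : ∫ v, f v = 0 := by
    have h2 : fourierReal f 0 = ∫ v, ((f v : ℝ) : ℂ) := by
      change (𝓕 (f.postcompCLM Complex.ofRealCLM) : 𝓢(Plane, ℂ)) 0 = _
      rw [SchwartzMap.fourier_coe, Real.fourier_eq]
      simp
    rw [hf, h1.zero.eq_of_nhds, integral_complex_ofReal, Pi.zero_apply] at h2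
    exact_mod_cast h2.symm
  refine ⟨⟨f, hmean⟩, ?_⟩
  refine Lp.ext ((memLp_weightNeg ⟨f, hmean⟩).coeFn_toLp.trans (Filter.EventuallyEq.trans
    (.of_forall fun κ => ?_) e.symm))
  change (weightNeg κ : ℂ) * fourierReal f κ = φ κ
  rw [hf, hφ.weight_cancel]

/-- Reflection `κ ↦ -κ` preserves the measure and is its own adjoint, so the symmetrisation can be
moved from `a` onto the test function. -/
theorem integral_mul_add_comp_neg {a ψ : Plane → ℝ} (ha : MemLp a 2) (hψ : MemLp ψ 2) (σ : ℝ) :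
    ∫ κ, ψ κ • (a κ + σ * a (-κ)) = ∫ κ, (ψ κ + σ * ψ (-κ)) * a κ := by
  have mp := Measure.measurePreserving_neg (volume : Measure Plane)
  have ha' : MemLp (fun κ => a (-κ)) 2 := ha.comp_measurePreserving mp
  have hψ' : MemLp (fun κ => ψ (-κ)) 2 := hψ.comp_measurePreserving mp
  have i1 : Integrable (fun κ => ψ κ * a κ) := hψ.integrable_mul ha
  have i2 : Integrable (fun κ => ψ κ * a (-κ)) := hψ.integrable_mul ha'
  have i3 : Integrable (fun κ => ψ (-κ) * a κ) := hψ'.integrable_mul ha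
  have e : ∫ κ, ψ κ * a (-κ) = ∫ κ, ψ (-κ) * a κ := by
    rw [← integral_neg_eq_self]
    simp
  have e1 : ∀ κ, ψ κ • (a κ + σ * a (-κ)) = ψ κ * a κ + σ * (ψ κ * a (-κ)) := fun κ => by
    rw [smul_eq_mul]
    ring
  have e2 : ∀ κ, (ψ κ + σ * ψ (-κ)) * a κ = ψ κ * a κ + σ * (ψ (-κ) * a κ) := fun κ => by ring
  simp_rw [e1, e2]
  rw [integral_add i1 (i2.const_mul σ), integral_add i1 (i3.const_mul σ), integral_const_mul,
    integral_const_mul, e]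

/-- This is the fundamental lemma of the calculus of variations on the complement of the origin; the
origin itself is a null set. -/
theorem ae_add_comp_neg_eq_zero {a : Plane → ℝ} (ha : MemLp a 2) {σ : ℝ}
    (h : ∀ ψ : Plane → ℝ, ContDiff ℝ (⊤ : ℕ∞) ψ → HasCompactSupport ψ → ψ =ᶠ[nhds 0] 0 →
      ∫ κ, (ψ κ + σ * ψ (-κ)) * a κ = 0) :
    ∀ᵐ κ, a κ + σ * a (-κ) = 0 := by
  have ha' : MemLp (fun κ => a (-κ)) 2 :=
    ha.comp_measurePreserving (Measure.measurePreserving_neg (volume : Measure Plane))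
  have hm : MemLp (fun κ => a κ + σ * a (-κ)) 2 := ha.add (ha'.const_mul σ)
  have key := (isOpen_compl_singleton (x := (0 : Plane))).ae_eq_zero_of_integral_contDiff_smul_eq_zero
    (μ := volume) ((hm.locallyIntegrable (by norm_num)).locallyIntegrableOn _)
    (fun ψ hψ hc hs => by
      rw [integral_mul_add_comp_neg ha (hψ.continuous.memLp_of_hasCompactSupport hc)]
      refine h ψ hψ hc ?_
      have h0 : (0 : Plane) ∉ tsupport ψ := fun h0 => hs h0 rfl
      exact notMem_tsupport_iff_eventuallyEq.1 h0)
  have h0 : ∀ᵐ κ : Plane, κ ≠ 0 := by simp [ae_iff]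
  filter_upwards [key, h0] with κ h1 h2 using h1 h2

/-- A function which is orthogonal to all test functions satisfies `F (-κ) = - conj (F κ)`. -/
theorem antiHermitian_of_mem_orthogonal {F : Lp ℂ 2 (volume : Measure Plane)}
    (hF : F ∈ testSpaceᗮ) : ∀ᵐ κ, (F (-κ)).re = -(F κ).re ∧ (F (-κ)).im = (F κ).im := by
  have hort : ∀ φ, IsHermitianTest φ →
      ∫ κ, ((φ κ).re * (F κ).re + (φ κ).im * (F κ).im) = 0 := by
    intro φ hφ
    obtain ⟨G, hG, e⟩ := hφ.exists_mem_testSpace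
    have := hF G hG
    rw [L2.inner_def] at this
    rw [← this]
    refine integral_congr_ae ?_
    filter_upwards [e] with κ hκ
    rw [hκ, Complex.inner]
    simp
    ring
  have hre : MemLp (fun κ => (F κ).re) 2 := (Lp.memLp F).re
  have him : MemLp (fun κ => (F κ).im) 2 := (Lp.memLp F).im
  have neg0 : ∀ {ψ : Plane → ℝ}, ψ =ᶠ[nhds 0] 0 → (fun κ => ψ (-κ)) =ᶠ[nhds 0] 0 := by
    intro ψ h0
    have : Filter.Tendsto (fun κ : Plane => -κ) (nhds 0) (nhds 0) := by
      simpa using (continuous_neg (G := Plane)).tendsto 0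
    exact this.eventually h0
  -- Real even test functions see only the even part of the real part of `F`.
  have h1 := ae_add_comp_neg_eq_zero hre (σ := 1) fun ψ hψ hc h0 => by
    have hn : ContDiff ℝ (⊤ : ℕ∞) fun κ => ψ (-κ) := hψ.comp contDiff_neg
    have hcn : HasCompactSupport fun κ => ψ (-κ) :=
      hc.comp_homeomorph (Homeomorph.neg Plane)
    have := hort (fun κ => ((ψ κ + ψ (-κ) : ℝ) : ℂ))
      ⟨Complex.ofRealCLM.contDiff.comp (hψ.add hn),
        (hc.add hcn).comp_left (g := fun x : ℝ => (x : ℂ)) Complex.ofReal_zero,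
        by
          filter_upwards [h0, neg0 h0] with κ k1 k2
          simp [k1, k2],
        fun κ => by rw [Complex.conj_ofReal, neg_neg, add_comm]⟩
    simpa using this
  -- The functions `I` times real odd are Hermitian too, and see only the odd part of the imaginary
  -- part of `F`.
  have h2 := ae_add_comp_neg_eq_zero him (σ := -1) fun ψ hψ hc h0 => by
    have hn : ContDiff ℝ (⊤ : ℕ∞) fun κ => ψ (-κ) := hψ.comp contDiff_neg
    have hcn : HasCompactSupport fun κ => ψ (-κ) :=
      hc.comp_homeomorph (Homeomorph.neg Plane)
    have := hort (fun κ => Complex.I * ((ψ κ - ψ (-κ) : ℝ) : ℂ))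
      ⟨contDiff_const.mul (Complex.ofRealCLM.contDiff.comp (hψ.sub hn)),
        ((hc.sub hcn).comp_left (g := fun x : ℝ => (x : ℂ)) Complex.ofReal_zero).mul_left,
        by
          filter_upwards [h0, neg0 h0] with κ k1 k2
          simp [k1, k2],
        fun κ => by
          rw [map_mul, Complex.conj_ofReal, Complex.conj_I, neg_neg]
          push_cast
          ring⟩
    simpa [sub_eq_add_neg] using this
  filter_upwards [h1, h2] with κ k1 k2
  constructor <;> linarith

/-- Against an anti-Hermitian `F`, the real inner product with a Hermitian `g` changes sign under `κ
↦ -κ`, so its integral equals its own negative. -/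
theorem mem_orthogonal_orthogonal_testSpace {G : Lp ℂ 2 (volume : Measure Plane)}
    {g : Plane → ℂ} (e : G =ᵐ[volume] g) (hg : ∀ κ, g (-κ) = (starRingEnd ℂ) (g κ)) :
    G ∈ testSpaceᗮᗮ := by
  intro F hF
  rw [L2.inner_def]
  have e1 : ∫ κ, inner ℝ (F κ) (G κ) = ∫ κ, inner ℝ (F κ) (g κ) := by
    refine integral_congr_ae ?_
    filter_upwards [e] with κ hκ
    rw [hκ]
  have e2 : ∫ κ, inner ℝ (F κ) (g κ) = -∫ κ, inner ℝ (F κ) (g κ) := by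
    rw [← integral_neg]
    nth_rewrite 1 [← integral_neg_eq_self]
    refine integral_congr_ae ?_
    filter_upwards [antiHermitian_of_mem_orthogonal hF] with κ hκ
    rw [Complex.inner, Complex.inner, hg]
    simp [hκ.1, hκ.2]
    ring
  rw [e1]
  linarith

/-- Fourier transforms of real functions are Hermitian and the weight is even, so the image of the
Schwartz class lies in the double orthogonal complement of the test functions, which is their
closure. Conversely every test function is itself an image. -/
theorem HPos_eq_closure_testSpace : HPos = testSpace.topologicalClosure := by
  refine le_antisymm ?_ (Submodule.topologicalClosure_mono fun F hF => ?_)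
  · refine Submodule.topologicalClosure_minimal _ ?_ (Submodule.isClosed_topologicalClosure _)
    rw [← Submodule.orthogonal_orthogonal_eq_closure]
    rintro _ ⟨f, rfl⟩
    refine mem_orthogonal_orthogonal_testSpace (memLp_weightPos f).coeFn_toLp fun κ => ?_
    rw [weightPos_neg, fourierReal_neg, map_mul, Complex.conj_ofReal]
  · obtain ⟨f, -, hf⟩ := exists_embedPos_eq hF
    exact ⟨f, hf⟩

theorem HNeg_eq_closure_testSpace : HNeg = testSpace.topologicalClosure := by
  refine le_antisymm ?_ (Submodule.topologicalClosure_mono fun F hF => ?_)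
  · refine Submodule.topologicalClosure_minimal _ ?_ (Submodule.isClosed_topologicalClosure _)
    rw [← Submodule.orthogonal_orthogonal_eq_closure]
    rintro _ ⟨f, rfl⟩
    refine mem_orthogonal_orthogonal_testSpace (memLp_weightNeg f).coeFn_toLp fun κ => ?_
    rw [weightNeg_neg, fourierReal_neg, map_mul, Complex.conj_ofReal]
  · obtain ⟨f, hf⟩ := exists_embedNeg_eq hF
    exact ⟨f, hf⟩


/-! ### A bounded right inverse of the trace on test functions -/

theorem norm_iteratedFDeriv_comp_le {E F G : Type*} [NormedAddCommGroup E] [NormedSpace ℝ E]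
    [NormedAddCommGroup F] [NormedSpace ℝ F] [NormedAddCommGroup G] [NormedSpace ℝ G]
    (f : 𝓢(E, F)) (L : G →L[ℝ] E) (hL : ‖L‖ ≤ 1) (n : ℕ) (x : G) :
    ‖iteratedFDeriv ℝ n (fun x => f (L x)) x‖ ≤ ‖iteratedFDeriv ℝ n f (L x)‖ := by
  have h := L.iteratedFDeriv_comp_right (f.smooth n) x (i := n) le_rfl
  change iteratedFDeriv ℝ n (fun x => f (L x)) x = _ at h
  rw [h]
  refine (ContinuousMultilinearMap.norm_compContinuousLinearMap_le _ _).trans ?_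
  refine mul_le_of_le_one_right (norm_nonneg _) (Finset.prod_le_one (fun _ _ => norm_nonneg _) ?_)
  exact fun _ _ => hL

/-- The product `f v * c y` of two Schwartz functions as a Schwartz function of `(v, y)`. -/
def tensor (f : 𝓢(Plane, ℝ)) (c : 𝓢(ℝ, ℝ)) : 𝓢(Space, ℝ) where
  toFun p := c p.2 * f p.1
  smooth' := ((c.smooth ⊤).comp contDiff_snd).mul ((f.smooth ⊤).comp contDiff_fst)
  decay' k n := by
    choose A hA0 hA using c.decay
    choose B hB0 hB using f.decay
    refine ⟨∑ i ∈ Finset.range (n + 1), (n.choose i : ℝ)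
      * (A 0 i * B k (n - i) + A k i * B 0 (n - i)), fun p => ?_⟩
    have h1 := norm_iteratedFDeriv_mul_le (n := n) (N := (⊤ : ℕ∞)) (𝕜 := ℝ)
      (f := fun p : Space => c p.2) (g := fun p : Space => f p.1)
      ((c.smooth ⊤).comp contDiff_snd) ((f.smooth ⊤).comp contDiff_fst) p (by exact_mod_cast le_top)
    refine (mul_le_mul_of_nonneg_left h1 (by positivity)).trans ?_
    rw [Finset.mul_sum]
    refine Finset.sum_le_sum fun i _ => ?_
    have k1 := norm_iteratedFDeriv_comp_le c (ContinuousLinearMap.snd ℝ Plane ℝ)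
      (ContinuousLinearMap.norm_snd_le ..) i p
    have k2 := norm_iteratedFDeriv_comp_le f (ContinuousLinearMap.fst ℝ Plane ℝ)
      (ContinuousLinearMap.norm_fst_le ..) (n - i) p
    simp only [ContinuousLinearMap.coe_snd', ContinuousLinearMap.coe_fst'] at k1 k2
    -- The norm on the product is the maximum, so in each Leibniz term the polynomial weight falls
    -- on one factor at a time.
    have k3 : ‖p‖ ^ k ≤ ‖p.1‖ ^ k + ‖p.2‖ ^ k := by
      rcases max_cases ‖p.1‖ ‖p.2‖ with h | h
      · rw [Prod.norm_def, h.1]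
        exact le_add_of_nonneg_right (by positivity)
      · rw [Prod.norm_def, h.1]
        exact le_add_of_nonneg_left (by positivity)
    have a0 := hA 0 i p.2
    have b0 := hB 0 (n - i) p.1
    have a1 := hA k i p.2
    have b1 := hB k (n - i) p.1
    rw [pow_zero, one_mul] at a0 b0
    have hA0' := (hA0 0 i).le
    have hA1' := (hA0 k i).le
    calc ‖p‖ ^ k * ((n.choose i : ℝ) * ‖iteratedFDeriv ℝ i (fun p : Space => c p.2) p‖
          * ‖iteratedFDeriv ℝ (n - i) (fun p : Space => f p.1) p‖)
        ≤ (‖p.1‖ ^ k + ‖p.2‖ ^ k) * ((n.choose i : ℝ) * ‖iteratedFDeriv ℝ i c p.2‖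
          * ‖iteratedFDeriv ℝ (n - i) f p.1‖) := by gcongr
      _ = (n.choose i : ℝ) * (‖iteratedFDeriv ℝ i c p.2‖
            * (‖p.1‖ ^ k * ‖iteratedFDeriv ℝ (n - i) f p.1‖)
          + (‖p.2‖ ^ k * ‖iteratedFDeriv ℝ i c p.2‖) * ‖iteratedFDeriv ℝ (n - i) f p.1‖) := by ring
      _ ≤ _ := by gcongr

theorem slice_tensor (f : 𝓢(Plane, ℝ)) (c : 𝓢(ℝ, ℝ)) (y : ℝ) :
    slice y (tensor f c) = c y • f := by
  ext v
  rfl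

/-- For every `n` there is a Schwartz function whose horizontal Fourier transform is
`(1 - (1 - y) s / (n + 1)) ^ (n + 1) φ`, where `s = weightPos ^ 2`, on a neighbourhood of the closed
slab. -/
theorem exists_slab_extension {φ : Plane → ℂ} (h : IsHermitianTest φ) (n : ℕ) :
    ∃ w : 𝓢(Space, ℝ), ∀ κ, ∀ y ∈ Ioo (-2 : ℝ) 2, fourierReal (slice y w) κ
      = (((1 - (1 - y) * weightPos κ ^ 2 / (n + 1)) ^ (n + 1) : ℝ) : ℂ) * φ κ := by
  have h1 : ∀ j : ℕ, ∃ f : 𝓢(Plane, ℝ), ∀ κ,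
      fourierReal f κ = (((weightPos κ ^ 2) ^ j : ℝ) : ℂ) * φ κ := fun j =>
    (h.mul (g := fun κ => (weightPos κ ^ 2) ^ j)
      (fun κ hκ => ((contDiffAt_weightPos hκ).pow 2).pow j)
      (fun κ => by rw [weightPos_neg])).exists_fourierReal
  choose f hf using h1
  -- The cutoff equals `1` on `[-2, 2]`: it makes the polynomial coefficients Schwartz without
  -- changing them near the closed slab.
  let χ : ContDiffBump (0 : ℝ) := ⟨2, 3, by norm_num, by norm_num⟩
  have hc : ∀ j : ℕ, ∃ c : 𝓢(ℝ, ℝ), ∀ y ∈ Ioo (-2 : ℝ) 2,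
      c y = ((n + 1).choose j : ℝ) * (-(1 - y) / (n + 1)) ^ j := fun j => by
    have hs : HasCompactSupport
        (fun y => χ y * (((n + 1).choose j : ℝ) * (-(1 - y) / (n + 1)) ^ j)) :=
      χ.hasCompactSupport.mul_right
    have hd : ContDiff ℝ (⊤ : ℕ∞)
        (fun y => χ y * (((n + 1).choose j : ℝ) * (-(1 - y) / (n + 1)) ^ j)) :=
      χ.contDiff.mul (by fun_prop)
    refine ⟨hs.toSchwartzMap hd, fun y hy => ?_⟩
    have : χ y = 1 := χ.one_of_mem_closedBall (by
      rw [mem_closedBall_zero_iff, Real.norm_eq_abs]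
      exact (abs_lt.2 hy).le)
    simp [this]
  choose c hc using hc
  -- The binomial expansion of the profile separates the variables: `f j` carries `s ^ j φ` and `c
  -- j` the matching polynomial in `1 - y`.
  refine ⟨∑ j ∈ Finset.range (n + 1 + 1), tensor (f j) (c j), fun κ y hy => ?_⟩
  have e1 : fourierReal (slice y (∑ j ∈ Finset.range (n + 1 + 1), tensor (f j) (c j))) κ
      = ∑ j ∈ Finset.range (n + 1 + 1), (c j y : ℂ) * fourierReal (f j) κ := by
    rw [map_sum, map_sum, sum_apply]
    refine Finset.sum_congr rfl fun j _ => ?_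
    rw [slice_tensor, map_smul, smul_apply, Complex.real_smul]
  have e2 : (1 - (1 - y) * weightPos κ ^ 2 / (n + 1)) ^ (n + 1)
      = ∑ j ∈ Finset.range (n + 1 + 1), c j y * (weightPos κ ^ 2) ^ j := by
    rw [show 1 - (1 - y) * weightPos κ ^ 2 / (n + 1)
      = -(1 - y) / (n + 1) * weightPos κ ^ 2 + 1 by ring, add_pow]
    refine Finset.sum_congr rfl fun j _ => ?_
    rw [hc j y hy, mul_pow, one_pow]
    ring
  rw [e1, e2, Complex.ofReal_sum, Finset.sum_mul]
  refine Finset.sum_congr rfl fun j _ => ?_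
  rw [hf]
  push_cast
  ring

/-- For `s ≤ n + 1` the base lies in `[0, 1]`, which gives the first bound. The second uses the
explicit antiderivative: its value at `y = 1` is `(n + 1) / (2 n + 1) ≤ 1` and its value at `y = 0`
is nonnegative. Together they mimic the decay of `∫ exp (-2 (1 - y) s) dy`. -/
theorem integral_profile_le {s : ℝ} (n : ℕ) (h0 : 0 ≤ s) (h1 : s ≤ n + 1) :
    ∫ y in (0 : ℝ)..1, (1 - (1 - y) * s / (n + 1)) ^ (2 * n) ≤ 1 ∧
    s * ∫ y in (0 : ℝ)..1, (1 - (1 - y) * s / (n + 1)) ^ (2 * n) ≤ 1 := by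
  have hn : (0 : ℝ) < n + 1 := by positivity
  have hb : ∀ y ∈ Icc (0 : ℝ) 1, 0 ≤ 1 - (1 - y) * s / (n + 1) ∧
      1 - (1 - y) * s / (n + 1) ≤ 1 := fun y hy => by
    have a1 : (1 - y) * s / (n + 1) ≤ 1 := by
      rw [div_le_one hn]
      nlinarith [hy.1, hy.2]
    have a2 : 0 ≤ (1 - y) * s / (n + 1) := by
      have := hy.2
      have : 0 ≤ 1 - y := by linarith
      positivity
    constructor <;> linarith
  have hc : Continuous fun y : ℝ => (1 - (1 - y) * s / (n + 1)) ^ (2 * n) := by fun_prop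
  constructor
  · calc ∫ y in (0 : ℝ)..1, (1 - (1 - y) * s / (n + 1)) ^ (2 * n)
        ≤ ∫ y in (0 : ℝ)..1, (1 : ℝ) :=
          intervalIntegral.integral_mono_on zero_le_one (hc.intervalIntegrable _ _)
            (continuous_const.intervalIntegrable _ _)
            fun y hy => pow_le_one₀ (hb y hy).1 (hb y hy).2
      _ = 1 := by simp
  · have hd : ∀ y ∈ uIcc (0 : ℝ) 1, HasDerivAt
        (fun y : ℝ => (n + 1 : ℝ) / (2 * n + 1) * (1 - (1 - y) * s / (n + 1)) ^ (2 * n + 1))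
        (s * (1 - (1 - y) * s / (n + 1)) ^ (2 * n)) y := fun y _ => by
      have a1 : HasDerivAt (fun y : ℝ => 1 - (1 - y) * s / (n + 1)) (s / (n + 1)) y := by
        have := ((((hasDerivAt_id y).const_sub 1).mul_const s).div_const (n + 1 : ℝ)).const_sub 1
        refine this.congr_deriv ?_
        ring
      refine ((a1.pow (2 * n + 1)).const_mul ((n + 1 : ℝ) / (2 * n + 1))).congr_deriv ?_
      have : (2 * n + 1 : ℝ) ≠ 0 := by positivity
      push_cast
      field_simp
    rw [← intervalIntegral.integral_const_mul, intervalIntegral.integral_eq_sub_of_hasDerivAt hd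
      ((continuous_const.mul hc).intervalIntegrable _ _)]
    have b0 := (hb 0 ⟨le_rfl, zero_le_one⟩).1
    have b1 : (n + 1 : ℝ) / (2 * n + 1) ≤ 1 := by
      rw [div_le_one (by positivity)]
      have : (0 : ℝ) ≤ n := n.cast_nonneg
      linarith
    have b2 : 0 ≤ (n + 1 : ℝ) / (2 * n + 1) * (1 - (1 - 0) * s / (n + 1)) ^ (2 * n + 1) := by
      positivity
    simp only [sub_self, zero_mul, zero_div, sub_zero, one_pow, mul_one] at b2 ⊢
    linarith

/-- With `q = |k|²` and `s = q / √(1 + q)`: for `q ≤ 1` the root is at most `2`, and for `q ≥ 1` one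
has `1 + q ≤ 2 q`. These low and high frequency cases match the two bounds of `integral_profile_le`.
-/
theorem waveNumber_sq_le (κ : Plane) :
    waveNumber κ ^ 2 ≤ 2 * weightPos κ ^ 2 ∨ waveNumber κ ^ 2 ≤ 2 * (weightPos κ ^ 2) ^ 2 := by
  have e : weightPos κ ^ 2 = waveNumber κ ^ 2 / Real.sqrt (1 + waveNumber κ ^ 2) := by
    have h : weightPos κ ^ 2 = (1 + waveNumber κ ^ 2) ^ (-(1 / 2) : ℝ) * waveNumber κ ^ 2 := by
      unfold weightPos
      rw [mul_pow, ← Real.rpow_natCast, ← Real.rpow_mul (by positivity)]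
      norm_num
    rw [h, Real.rpow_neg (by positivity), ← Real.sqrt_eq_rpow, inv_mul_eq_div]
  rw [e]
  set q := waveNumber κ ^ 2
  have hq : 0 ≤ q := by positivity
  have hr : 0 < Real.sqrt (1 + q) := Real.sqrt_pos.2 (by positivity)
  rcases le_total q 1 with h | h
  · left
    rw [← mul_div_assoc, le_div_iff₀ hr]
    have : Real.sqrt (1 + q) ≤ 2 := by
      rw [Real.sqrt_le_iff]
      constructor <;> linarith
    nlinarith
  · right
    rw [div_pow, Real.sq_sqrt (by positivity), ← mul_div_assoc, le_div_iff₀ (by positivity)]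
    nlinarith

/-- The horizontal derivatives contribute `|k|²` times the squared profile. The `y`-derivative of
the profile is exactly `s` times the `n`-th power of the base, the factor `n + 1` cancelling, so
both parts share the power `2 n`. -/
theorem fourierEnergy_of_extension {φ : Plane → ℂ} {n : ℕ} {w : 𝓢(Space, ℝ)}
    (hw : ∀ κ, ∀ y ∈ Ioo (-2 : ℝ) 2, fourierReal (slice y w) κ
      = (((1 - (1 - y) * weightPos κ ^ 2 / (n + 1)) ^ (n + 1) : ℝ) : ℂ) * φ κ)
    (κ : Plane) {y : ℝ} (hy : y ∈ Ioo (-2 : ℝ) 2) :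
    fourierEnergy w κ y = (waveNumber κ ^ 2 * (1 - (1 - y) * weightPos κ ^ 2 / (n + 1)) ^ 2
      + (weightPos κ ^ 2) ^ 2) * (1 - (1 - y) * weightPos κ ^ 2 / (n + 1)) ^ (2 * n)
        * ‖φ κ‖ ^ 2 := by
  set s := weightPos κ ^ 2
  have h1 : fourierReal (slice y (∂_{dirY} w)) κ
      = ((s * (1 - (1 - y) * s / (n + 1)) ^ n : ℝ) : ℂ) * φ κ := by
    have a1 : HasDerivAt (fun y : ℝ => 1 - (1 - y) * s / (n + 1)) (s / (n + 1)) y := by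
      have := ((((hasDerivAt_id y).const_sub 1).mul_const s).div_const (n + 1 : ℝ)).const_sub 1
      refine this.congr_deriv ?_
      ring
    have a2 : HasDerivAt (fun y : ℝ => (1 - (1 - y) * s / (n + 1)) ^ (n + 1))
        (s * (1 - (1 - y) * s / (n + 1)) ^ n) y := by
      refine (a1.pow (n + 1)).congr_deriv ?_
      have : (n + 1 : ℝ) ≠ 0 := by positivity
      push_cast
      field_simp
    -- The formula for the slices holds on an open interval around `y`, so it may be differentiated
    -- there.
    refine (hasDerivAt_fourierReal_slice w κ y).unique
      ((a2.ofReal_comp.mul_const (φ κ)).congr_of_eventuallyEq ?_)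
    filter_upwards [isOpen_Ioo.mem_nhds hy] with t ht using hw κ t ht
  have h2 : ∀ r : ℝ, ‖(r : ℂ) * φ κ‖ ^ 2 = r ^ 2 * ‖φ κ‖ ^ 2 := fun r => by
    rw [norm_mul, mul_pow, Complex.norm_real, Real.norm_eq_abs, sq_abs]
  rw [fourierEnergy, ← waveNumber_sq_mul, h1, hw κ y hy, h2, h2]
  ring

/-- The constant is `3 = 2 + 1`: with `I` the integral of the profile, `|k|² I ≤ 2 s` in either
frequency range, and `s² I ≤ s`. -/
theorem integral_fourierEnergy_le {φ : Plane → ℂ} {n : ℕ} {w : 𝓢(Space, ℝ)}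
    (hw : ∀ κ, ∀ y ∈ Ioo (-2 : ℝ) 2, fourierReal (slice y w) κ
      = (((1 - (1 - y) * weightPos κ ^ 2 / (n + 1)) ^ (n + 1) : ℝ) : ℂ) * φ κ)
    {κ : Plane} (hn : φ κ ≠ 0 → weightPos κ ^ 2 ≤ n + 1) :
    ∫ y in (0 : ℝ)..1, fourierEnergy w κ y ≤ 3 * ‖(weightPos κ : ℂ) * φ κ‖ ^ 2 := by
  rw [norm_mul, mul_pow, Complex.norm_real, Real.norm_eq_abs, sq_abs]
  have hE : Continuous (fun y => fourierEnergy w κ y) := by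
    have h0 := (continuous_fourierEnergy w).comp (by fun_prop : Continuous fun t : ℝ => (κ, t))
    simpa only [Function.comp_def] using h0
  set s := weightPos κ ^ 2 with hs
  have hs0 : 0 ≤ s := by positivity
  have hsub : ∀ y ∈ Icc (0 : ℝ) 1, y ∈ Ioo (-2 : ℝ) 2 := fun y hy =>
    ⟨by linarith [hy.1], by linarith [hy.2]⟩
  have hn0 : (0 : ℝ) < n + 1 := by positivity
  have hc : Continuous fun y : ℝ => (1 - (1 - y) * s / (n + 1)) ^ (2 * n) := by fun_prop
  by_cases hφ : φ κ = 0
  · have : ∫ y in (0 : ℝ)..1, fourierEnergy w κ y = ∫ y in (0 : ℝ)..1, (0 : ℝ) := by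
      refine intervalIntegral.integral_congr fun y hy => ?_
      rw [uIcc_of_le zero_le_one] at hy
      rw [fourierEnergy_of_extension hw κ (hsub y hy), hφ, norm_zero]
      ring
    rw [this, hφ]
    simp
  · have hsn := hn hφ
    obtain ⟨i1, i2⟩ := integral_profile_le n hs0 hsn
    set I := ∫ y in (0 : ℝ)..1, (1 - (1 - y) * s / (n + 1)) ^ (2 * n) with hI
    have hI0 : 0 ≤ I :=
      intervalIntegral.integral_nonneg zero_le_one fun y _ => (even_two_mul n).pow_nonneg _
    have step : ∫ y in (0 : ℝ)..1, fourierEnergy w κ y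
        ≤ ∫ y in (0 : ℝ)..1, (waveNumber κ ^ 2 + s ^ 2) * ‖φ κ‖ ^ 2
          * (1 - (1 - y) * s / (n + 1)) ^ (2 * n) := by
      refine intervalIntegral.integral_mono_on zero_le_one (hE.intervalIntegrable _ _)
        ((continuous_const.mul hc).intervalIntegrable _ _) fun y hy => ?_
      rw [fourierEnergy_of_extension hw κ (hsub y hy), ← hs, mul_right_comm]
      have a1 : (1 - y) * s / (n + 1) ≤ 1 := by
        rw [div_le_one hn0]
        nlinarith [hy.1, hy.2]
      have a2 : 0 ≤ (1 - y) * s / (n + 1) := by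
        have : 0 ≤ 1 - y := by linarith [hy.2]
        positivity
      have a3 : (1 - (1 - y) * s / (n + 1)) ^ 2 ≤ 1 :=
        pow_le_one₀ (by linarith) (by linarith)
      have a4 : 0 ≤ (1 - (1 - y) * s / (n + 1)) ^ (2 * n) := (even_two_mul n).pow_nonneg _
      gcongr
      exact mul_le_of_le_one_right (by positivity) a3
    rw [intervalIntegral.integral_const_mul, ← hI] at step
    have key : (waveNumber κ ^ 2 + s ^ 2) * I ≤ 3 * s := by
      have b1 : s ^ 2 * I ≤ s := by nlinarith
      have b2 : waveNumber κ ^ 2 * I ≤ 2 * s := by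
        rcases waveNumber_sq_le κ with h | h
        · calc waveNumber κ ^ 2 * I ≤ 2 * s * 1 := by gcongr
            _ = 2 * s := mul_one _
        · calc waveNumber κ ^ 2 * I ≤ 2 * s ^ 2 * I := by gcongr
            _ ≤ 2 * s := by linarith
      linarith
    calc _ ≤ _ := step
      _ = (waveNumber κ ^ 2 + s ^ 2) * I * ‖φ κ‖ ^ 2 := by ring
      _ ≤ 3 * s * ‖φ κ‖ ^ 2 := by gcongr
      _ = 3 * (s * ‖φ κ‖ ^ 2) := by ring

/-- Plancherel on each horizontal slice, then Tonelli. -/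
theorem sq_norm_toH1Star_eq_fourier (f : 𝓢(Space, ℝ)) : ENNReal.ofReal (‖toH1Star f‖ ^ 2)
    = ∫⁻ κ, ENNReal.ofReal (∫ y in (0 : ℝ)..1, fourierEnergy f κ y) := by
  have e : ∀ κ, ENNReal.ofReal (∫ y in (0 : ℝ)..1, fourierEnergy f κ y)
      = ∫⁻ y in Ioo (0 : ℝ) 1, ENNReal.ofReal (fourierEnergy f κ y) := fun κ => by
    have hE : Continuous (fun y => fourierEnergy f κ y) := by
      have h0 := (continuous_fourierEnergy f).comp (by fun_prop : Continuous fun t : ℝ => (κ, t))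
      simpa only [Function.comp_def] using h0
    rw [intervalIntegral.integral_of_le zero_le_one, integral_Ioc_eq_integral_Ioo,
      ofReal_integral_eq_lintegral_ofReal
        ((hE.integrableOn_Icc (a := (0 : ℝ)) (b := 1)).mono_set Ioo_subset_Icc_self)]
    refine .of_forall fun y => ?_
    change 0 ≤ fourierEnergy f κ y
    unfold fourierEnergy
    positivity
  simp_rw [e]
  rw [lintegral_lintegral_swap
      (continuous_fourierEnergy f).measurable.ennreal_ofReal.aemeasurable,
    sq_norm_toH1Star, slabMeasure_eq, lintegral_prod_symm' _ (measurable_gradSq f)]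
  refine lintegral_congr fun y => ?_
  rw [lintegral_fourierEnergy]
  rfl

/-- A Schwartz function on the plane whose Fourier transform is a test function is the trace of a
function on the slab of comparable norm. -/
theorem exists_trace_eq {f : 𝓢(Plane, ℝ)} (hf : IsHermitianTest (fourierReal f)) :
    ∃ u : H1Star, trace u = toHPos f ∧ ‖u‖ ^ 2 ≤ 3 * ‖toHPos f‖ ^ 2 := by
  -- Compact support in frequency bounds `s ≤ |k|`, so one exponent serves all frequencies.
  obtain ⟨n, hn⟩ : ∃ n : ℕ, ∀ κ, fourierReal f κ ≠ 0 → weightPos κ ^ 2 ≤ n + 1 := by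
    obtain ⟨R, hR⟩ := hf.compact.isCompact.isBounded.exists_norm_le
    obtain ⟨n, hn⟩ := exists_nat_ge (2 * Real.pi * R)
    refine ⟨n, fun κ hκ => (weightPos_sq_le κ).trans ?_⟩
    have h1 := hR κ (subset_tsupport _ hκ)
    have h2 : waveNumber κ ≤ 2 * Real.pi * R := by
      have := Real.pi_pos
      unfold waveNumber
      gcongr
    linarith
  obtain ⟨w, hw⟩ := exists_slab_extension hf n
  refine ⟨toH1Star w, ?_, ?_⟩
  · rw [trace_toH1Star]
    refine Subtype.ext (Lp.ext ((memLp_weightPos _).coeFn_toLp.trans (Filter.EventuallyEq.trans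
      (.of_forall fun κ => ?_) (memLp_weightPos f).coeFn_toLp.symm)))
    change (weightPos κ : ℂ) * fourierReal (slice 1 w) κ = (weightPos κ : ℂ) * fourierReal f κ
    rw [hw κ 1 (by norm_num)]
    simp
  · have h1 : ENNReal.ofReal (‖toHPos f‖ ^ 2)
        = ∫⁻ κ, ENNReal.ofReal (‖(weightPos κ : ℂ) * fourierReal f κ‖ ^ 2) :=
      sq_norm_toLp (memLp_weightPos f)
    rw [← ENNReal.ofReal_le_ofReal_iff (by positivity), ENNReal.ofReal_mul (by norm_num), h1,
      ← lintegral_const_mul' _ _ (by norm_num), sq_norm_toH1Star_eq_fourier]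
    refine lintegral_mono fun κ => ?_
    rw [← ENNReal.ofReal_mul (by norm_num)]
    exact ENNReal.ofReal_le_ofReal (integral_fourierEnergy_le hw (hn κ))


/-! ### Coercive operators -/

/-- Lax–Milgram for the bilinear form `⟨S v, w⟩`. -/
theorem isUnit_of_coercive {V : Type*} [NormedAddCommGroup V] [InnerProductSpace ℝ V]
    [CompleteSpace V] {S : V →L[ℝ] V} {c : ℝ} (hc : 0 < c)
    (h : ∀ v, c * ‖v‖ ^ 2 ≤ inner ℝ (S v) v) : IsUnit S := by
  have hB : IsCoercive ((innerSL ℝ).comp S : V →L[ℝ] V →L[ℝ] ℝ) :=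
    ⟨c, hc, fun v => by simpa [sq, mul_assoc] using h v⟩
  have e : S = (hB.continuousLinearEquivOfBilin : V →L[ℝ] V) := by
    ext v
    exact hB.unique_continuousLinearEquivOfBilin fun w => rfl
  rw [e]
  exact (ContinuousLinearEquiv.unitsEquiv ℝ V |>.symm hB.continuousLinearEquivOfBilin).isUnit

/-- With `v = S w` coercivity reads `⟨w, v⟩ ≥ c ‖w‖²`, and `‖v‖ ≤ K ‖w‖` converts this into a bound
in `‖v‖`. -/
theorem ring_inverse_coercive {V : Type*} [NormedAddCommGroup V] [InnerProductSpace ℝ V]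
    [CompleteSpace V] {S : V →L[ℝ] V} {c : ℝ} (hc : 0 < c)
    (h : ∀ v, c * ‖v‖ ^ 2 ≤ inner ℝ (S v) v) {K : ℝ} (hK : ‖S‖ ≤ K) (hK0 : 0 < K) (v : V) :
    c / K ^ 2 * ‖v‖ ^ 2 ≤ inner ℝ (Ring.inverse S v) v := by
  have h1 : S (Ring.inverse S v) = v :=
    congrArg (fun T : V →L[ℝ] V => T v) (Ring.mul_inverse_cancel S (isUnit_of_coercive hc h))
  have h2 := h (Ring.inverse S v)
  rw [h1, real_inner_comm] at h2
  refine le_trans ?_ h2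
  have h3 : ‖v‖ ≤ K * ‖Ring.inverse S v‖ := by
    calc ‖v‖ = ‖S (Ring.inverse S v)‖ := by rw [h1]
      _ ≤ ‖S‖ * ‖Ring.inverse S v‖ := S.le_opNorm _
      _ ≤ _ := by gcongr
  rw [div_mul_eq_mul_div, div_le_iff₀ (by positivity)]
  calc c * ‖v‖ ^ 2 ≤ c * (K * ‖Ring.inverse S v‖) ^ 2 := by gcongr
    _ = _ := by ring

theorem norm_ring_inverse_apply_le {V : Type*} [NormedAddCommGroup V] [InnerProductSpace ℝ V]
    [CompleteSpace V] {S : V →L[ℝ] V} {c : ℝ} (hc : 0 < c)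
    (h : ∀ v, c * ‖v‖ ^ 2 ≤ inner ℝ (S v) v) (v : V) : ‖Ring.inverse S v‖ ≤ c⁻¹ * ‖v‖ := by
  have h1 : S (Ring.inverse S v) = v :=
    congrArg (fun T : V →L[ℝ] V => T v) (Ring.mul_inverse_cancel S (isUnit_of_coercive hc h))
  have h2 := (h (Ring.inverse S v)).trans (real_inner_le_norm _ _)
  rw [h1] at h2
  rw [inv_mul_eq_div, le_div_iff₀ hc]
  rcases (norm_nonneg (Ring.inverse S v)).eq_or_lt with h0 | h0
  · rw [← h0, zero_mul]
    exact norm_nonneg v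
  · nlinarith

/-- For fixed `T` and `R`, the map `S ↦ T S R` is continuous linear. -/
theorem analyticAt_comp_comp {E F G H V : Type*} [NormedAddCommGroup E] [NormedSpace ℝ E]
    [NormedAddCommGroup F] [NormedSpace ℝ F] [NormedAddCommGroup G] [NormedSpace ℝ G]
    [NormedAddCommGroup H] [NormedSpace ℝ H] [NormedAddCommGroup V] [NormedSpace ℝ V]
    (T : G →L[ℝ] H) (R : E →L[ℝ] F) {S : V → F →L[ℝ] G} {x : V} (h : AnalyticAt ℝ S x) :
    AnalyticAt ℝ (fun v => T ∘L S v ∘L R) x :=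
  ((ContinuousLinearMap.compL ℝ E G H T ∘L
    (ContinuousLinearMap.compL ℝ E F G).flip R).analyticAt (S x)).fun_comp h

/-! ### The trace operator and its adjoint -/

instance : CompleteSpace H1Star := by
  unfold H1Star
  infer_instance

/-- The identification of `H_⋆^{-1/2}(ℝ²)` with the dual of `H_⋆^{1/2}(ℝ²)`. -/
def dualEquiv : HNeg ≃ₗᵢ[ℝ] HPos :=
  LinearIsometryEquiv.ofEq HNeg HPos
    (HNeg_eq_closure_testSpace.trans HPos_eq_closure_testSpace.symm)

theorem pairing_eq (ξ : HNeg) (Φ : HPos) : pairing ξ Φ = inner ℝ (dualEquiv ξ) Φ := rfl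

/-- The adjoint of the trace. -/
def traceAdjoint : HPos →L[ℝ] H1Star := ContinuousLinearMap.adjoint trace

/-- Dual form of the extension estimate: a test element `Φ` is the trace of some `u` with `‖u‖ ≤ √3
‖Φ‖`, so `⟨ξ, Φ⟩ = ⟨T* ξ, u⟩ ≤ √3 ‖T* ξ‖ ‖Φ‖`. -/
theorem traceAdjoint_bounded_below (ξ : HPos) : ‖ξ‖ ^ 2 ≤ 3 * ‖traceAdjoint ξ‖ ^ 2 := by
  have h1 : ∀ Φ ∈ (testSpace : Set (Lp ℂ 2 (volume : Measure Plane))),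
      inner ℝ (ξ : Lp ℂ 2 (volume : Measure Plane)) Φ ≤ Real.sqrt 3 * ‖traceAdjoint ξ‖ * ‖Φ‖ := by
    intro Φ hΦ
    obtain ⟨f, hf, rfl⟩ := exists_embedPos_eq hΦ
    obtain ⟨u, hu, hb⟩ := exists_trace_eq hf
    have e : inner ℝ (ξ : Lp ℂ 2 (volume : Measure Plane)) (embedPos f)
        = inner ℝ (traceAdjoint ξ) u := by
      rw [traceAdjoint, ContinuousLinearMap.adjoint_inner_left, hu]
      rfl
    have hb' : ‖u‖ ≤ Real.sqrt 3 * ‖embedPos f‖ := by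
      refine (abs_le_of_sq_le_sq' ?_ (by positivity)).2
      rw [mul_pow, Real.sq_sqrt (by norm_num)]
      exact hb
    rw [e]
    calc _ ≤ ‖traceAdjoint ξ‖ * ‖u‖ := real_inner_le_norm _ _
      _ ≤ ‖traceAdjoint ξ‖ * (Real.sqrt 3 * ‖embedPos f‖) := by gcongr
      _ = _ := by ring
  have h2 : (ξ : Lp ℂ 2 (volume : Measure Plane)) ∈ closure (testSpace : Set _) := by
    have h := HPos_eq_closure_testSpace.le ξ.2
    rwa [← SetLike.mem_coe, Submodule.topologicalClosure_coe] at h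
  -- The inequality is closed in `Φ` and test elements are dense, so `Φ = ξ` is admissible.
  have h3 := le_on_closure h1 (by fun_prop) (by fun_prop) h2
  rw [real_inner_self_eq_norm_sq] at h3
  change ‖ξ‖ ^ 2 ≤ Real.sqrt 3 * ‖traceAdjoint ξ‖ * ‖ξ‖ at h3
  have h4 : ‖ξ‖ ≤ Real.sqrt 3 * ‖traceAdjoint ξ‖ := by
    rcases (norm_nonneg ξ).eq_or_lt with h0 | h0
    · rw [← h0]
      positivity
    · nlinarith
  calc ‖ξ‖ ^ 2 ≤ (Real.sqrt 3 * ‖traceAdjoint ξ‖) ^ 2 := by gcongr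
    _ = _ := by rw [mul_pow, Real.sq_sqrt (by norm_num)]

/-! ### The weak formulation as an operator equation -/

/-- The operator of the weak formulation on `H_⋆^1(Σ)`, in terms of the coefficient operator. -/
def compress (M : VectorField →L[ℝ] VectorField) : H1Star →L[ℝ] H1Star :=
  ContinuousLinearMap.adjoint H1Star.subtypeL ∘L M ∘L H1Star.subtypeL

theorem inner_compress (M : VectorField →L[ℝ] VectorField) (u w : H1Star) :
    inner ℝ (compress M u) w = inner ℝ (M u.1) w.1 :=
  ContinuousLinearMap.adjoint_inner_left H1Star.subtypeL w (M u.1)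

theorem norm_compress_le (M : VectorField →L[ℝ] VectorField) : ‖compress M‖ ≤ ‖M‖ := by
  refine ContinuousLinearMap.opNorm_le_bound _ (norm_nonneg _) fun u => ?_
  have h1 : ‖compress M u‖ ^ 2 ≤ ‖M‖ * ‖u‖ * ‖compress M u‖ := by
    rw [← real_inner_self_eq_norm_sq, inner_compress]
    refine (real_inner_le_norm _ _).trans ?_
    gcongr
    · exact M.le_opNorm u.1
    · exact le_rfl
  rcases (norm_nonneg (compress M u)).eq_or_lt with h0 | h0
  · rw [← h0]
    positivity
  · nlinarith

/-- The operator of the weak formulation for the surface `η`. -/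
def weakOp (η : W1inf) : H1Star →L[ℝ] H1Star := compress (coeffOp η)

theorem weakOp_coercive {η : W1inf} (hη : ‖η‖ < 1 / 2) (u : H1Star) :
    1 / 8 * ‖u‖ ^ 2 ≤ inner ℝ (weakOp η u) u := by
  rw [weakOp, inner_compress]
  exact coeffOp_coercive hη u.1

theorem isUnit_weakOp {η : W1inf} (hη : ‖η‖ < 1 / 2) : IsUnit (weakOp η) :=
  isUnit_of_coercive (by norm_num) (weakOp_coercive hη)

theorem isWeakSolution_iff {η : W1inf} (hη : ‖η‖ < 1 / 2) (ξ : HNeg) (u : H1Star) :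
    IsWeakSolution η ξ u ↔ weakOp η u = traceAdjoint (dualEquiv ξ) := by
  have h : ∀ w, inner ℝ (traceAdjoint (dualEquiv ξ)) w = pairing ξ (trace w) := fun w =>
    ContinuousLinearMap.adjoint_inner_left trace w (dualEquiv ξ)
  constructor
  · intro hu
    refine ext_inner_right ℝ fun w => ?_
    rw [h, weakOp, inner_compress, inner_coeffOp hη, hu w]
    ring
  · intro hu w
    have := inner_coeffOp hη u w
    rw [← inner_compress, ← weakOp, hu, h] at this
    linarith

/-- The Neumann-Dirichlet operator as an operator on `H_⋆^{1/2}(ℝ²)`. -/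
def neumannOp (η : W1inf) : HPos →L[ℝ] HPos :=
  trace ∘L Ring.inverse (weakOp η) ∘L traceAdjoint

/-- A solution exists for every `ξ` and determines `N ξ`, so the operator picked by choice can only
be `T (weakOp η)⁻¹ T*` after the identification. -/
theorem neumannDirichlet_spec {η : W1inf} (hη : ‖η‖ < 1 / 2) :
    IsNeumannDirichlet η (neumannDirichlet η) ∧
      neumannDirichlet η = neumannOp η ∘L (dualEquiv : HNeg →L[ℝ] HPos) := by
  have hu := isUnit_weakOp hη
  have hr : ∀ x, weakOp η (Ring.inverse (weakOp η) x) = x := fun x =>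
    congrArg (fun T : H1Star →L[ℝ] H1Star => T x) (Ring.mul_inverse_cancel _ hu)
  have hl : ∀ x, Ring.inverse (weakOp η) (weakOp η x) = x := fun x =>
    congrArg (fun T : H1Star →L[ℝ] H1Star => T x) (Ring.inverse_mul_cancel _ hu)
  have hsol : ∀ ξ u, IsWeakSolution η ξ u ↔
      u = Ring.inverse (weakOp η) (traceAdjoint (dualEquiv ξ)) := fun ξ u => by
    rw [isWeakSolution_iff hη]
    exact ⟨fun h => by rw [← h, hl], fun h => by rw [h, hr]⟩
  have hex : ∃ N, IsNeumannDirichlet η N := by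
    refine ⟨neumannOp η ∘L (dualEquiv : HNeg →L[ℝ] HPos), fun ξ => ⟨?_, fun u h => ?_⟩⟩
    · exact ⟨_, (hsol ξ _).2 rfl, fun u h => (hsol ξ u).1 h⟩
    · rw [(hsol ξ u).1 h]
      rfl
  have hN : IsNeumannDirichlet η (neumannDirichlet η) := by
    rw [neumannDirichlet, dif_pos hex]
    exact hex.choose_spec
  refine ⟨hN, ?_⟩
  ext1 ξ
  exact (hN ξ).2 _ ((hsol ξ _).2 rfl)

/-! ### Analyticity, coercivity and inversion of the Neumann–Dirichlet operator -/

theorem eventually_norm_lt_half : ∀ᶠ η : W1inf in nhds 0, ‖η‖ < 1 / 2 := by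
  have := Metric.ball_mem_nhds (0 : W1inf) (show (0 : ℝ) < 1 / 2 by norm_num)
  filter_upwards [this] with η hη using mem_ball_zero_iff.1 hη

theorem analyticAt_ring_inverse_comp {A V : Type*} [NormedAddCommGroup V] [NormedSpace ℝ V]
    [NormedRing A] [NormedAlgebra ℝ A] [HasSummableGeomSeries A] {S : V → A} {x : V}
    (h : AnalyticAt ℝ S x) (hu : IsUnit (S x)) : AnalyticAt ℝ (fun v => Ring.inverse (S v)) x := by
  obtain ⟨a, ha⟩ := hu
  have h1 : AnalyticAt ℝ (Ring.inverse : A → A) (S x) := by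
    rw [← ha]
    exact analyticAt_inverse a
  exact h1.fun_comp h

theorem analyticAt_neumannOp : AnalyticAt ℝ neumannOp 0 := by
  have h1 : AnalyticAt ℝ weakOp 0 := 
    analyticAt_comp_comp (ContinuousLinearMap.adjoint H1Star.subtypeL) H1Star.subtypeL
      analyticAt_coeffOp
  have h2 := analyticAt_ring_inverse_comp (S := weakOp) h1 (isUnit_weakOp (η := 0) (by simp))
  exact analyticAt_comp_comp trace traceAdjoint h2

/-- `⟨T B T* ξ, ξ⟩ = ⟨B T* ξ, T* ξ⟩` with `B = (weakOp η)⁻¹`. The constant `1/24` is the ellipticity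
`1/8` divided by the `3` of `traceAdjoint_bounded_below`. -/
theorem neumannOp_coercive {η : W1inf} (hη : ‖η‖ < 1 / 2) {K : ℝ} (hK : ‖coeffOp η‖ ≤ K)
    (hK0 : 0 < K) (ξ : HPos) :
    1 / 24 / K ^ 2 * ‖ξ‖ ^ 2 ≤ inner ℝ (neumannOp η ξ) ξ := by
  have h1 := ring_inverse_coercive (by norm_num) (weakOp_coercive hη)
    ((norm_compress_le _).trans hK) hK0 (traceAdjoint ξ)
  have h2 := traceAdjoint_bounded_below ξ
  have e : inner ℝ (neumannOp η ξ) ξ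
      = inner ℝ (Ring.inverse (weakOp η) (traceAdjoint ξ)) (traceAdjoint ξ) :=
    (ContinuousLinearMap.adjoint_inner_right trace _ ξ).symm
  rw [e]
  refine le_trans ?_ h1
  calc 1 / 24 / K ^ 2 * ‖ξ‖ ^ 2 ≤ 1 / 24 / K ^ 2 * (3 * ‖traceAdjoint ξ‖ ^ 2) := by gcongr
    _ = _ := by ring

theorem norm_neumannOp_apply_le {η : W1inf} (hη : ‖η‖ < 1 / 2) (ξ : HPos) :
    ‖neumannOp η ξ‖ ≤ 8 * ‖(trace : H1Star →L[ℝ] HPos)‖ ^ 2 * ‖ξ‖ := by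
  have h1 := norm_ring_inverse_apply_le (by norm_num) (weakOp_coercive hη) (traceAdjoint ξ)
  have h2 : ‖traceAdjoint ξ‖ ≤ ‖(trace : H1Star →L[ℝ] HPos)‖ * ‖ξ‖ := by
    have := traceAdjoint.le_opNorm ξ
    rwa [traceAdjoint, LinearIsometryEquiv.norm_map] at this
  calc ‖neumannOp η ξ‖ ≤ ‖(trace : H1Star →L[ℝ] HPos)‖
        * ‖Ring.inverse (weakOp η) (traceAdjoint ξ)‖ := trace.le_opNorm _
    _ ≤ ‖(trace : H1Star →L[ℝ] HPos)‖
        * ((1 / 8)⁻¹ * (‖(trace : H1Star →L[ℝ] HPos)‖ * ‖ξ‖)) := by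
        gcongr
        exact h1.trans (by gcongr)
    _ = _ := by ring

/-- Near the origin the coefficient operators are uniformly bounded. -/
theorem exists_coeffOp_bound : ∃ M K : ℝ, 0 < M ∧ M ≤ 1 / 2 ∧ 0 < K ∧
    ∀ η : W1inf, ‖η‖ < M → ‖coeffOp η‖ ≤ K := by
  -- Invertibility needs only `‖η‖ < 1/2`; the radius is shrunk here to make the constants uniform
  -- in `η`, using that analyticity implies continuity at `0`.
  have h1 : ∀ᶠ η in nhds (0 : W1inf), ‖coeffOp η‖ < ‖coeffOp 0‖ + 1 :=
    analyticAt_coeffOp.continuousAt.norm.eventually_lt_const (by linarith)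
  obtain ⟨r, hr, h⟩ := Metric.eventually_nhds_iff.1 h1
  refine ⟨min r (1 / 2), ‖coeffOp 0‖ + 1, by positivity, min_le_right _ _, by positivity,
    fun η hη => (h ?_).le⟩
  rw [dist_zero_right]
  exact hη.trans_le (min_le_left _ _)

theorem dirichletNeumann_eq {η : W1inf} (hη : ‖η‖ < 1 / 2) :
    dirichletNeumann η = (dualEquiv.toContinuousLinearEquiv.symm : HPos →L[ℝ] HNeg) ∘L
      Ring.inverse (neumannOp η) := by
  rw [dirichletNeumann, (neumannDirichlet_spec hη).2, ContinuousLinearMap.ringInverse_eq_inverse]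
  exact ContinuousLinearMap.inverse_comp_equiv (e := dualEquiv.toContinuousLinearEquiv)

theorem analyticAt_neumannDirichlet : AnalyticAt ℝ neumannDirichlet 0 := by
  have h := analyticAt_comp_comp (ContinuousLinearMap.id ℝ HPos) (dualEquiv : HNeg →L[ℝ] HPos)
    analyticAt_neumannOp
  -- The explicit formula is available only for `‖η‖ < 1/2`, but analyticity at `0` depends only on
  -- the germ there.
  refine h.congr ?_
  filter_upwards [eventually_norm_lt_half] with η hη using (neumannDirichlet_spec hη).2.symm

theorem isUnit_neumannOp {η : W1inf} (hη : ‖η‖ < 1 / 2) : IsUnit (neumannOp η) := by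
  have hK : ‖coeffOp η‖ ≤ ‖coeffOp η‖ + 1 := by linarith
  exact isUnit_of_coercive (by positivity) (neumannOp_coercive hη hK (by positivity))

theorem analyticAt_dirichletNeumann : AnalyticAt ℝ dirichletNeumann 0 := by
  have h1 := analyticAt_ring_inverse_comp (S := neumannOp) analyticAt_neumannOp
    (isUnit_neumannOp (η := 0) (by simp))
  have h := analyticAt_comp_comp
    (dualEquiv.toContinuousLinearEquiv.symm : HPos →L[ℝ] HNeg) (ContinuousLinearMap.id ℝ HPos) h1
  refine h.congr ?_
  filter_upwards [eventually_norm_lt_half] with η hη using (dirichletNeumann_eq hη).symm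

theorem isInvertible_neumannDirichlet {η : W1inf} (hη : ‖η‖ < 1 / 2) :
    (neumannDirichlet η).IsInvertible := by
  rw [(neumannDirichlet_spec hη).2]
  obtain ⟨a, ha⟩ := isUnit_neumannOp hη
  rw [← ha]
  exact ContinuousLinearMap.IsInvertible.comp
    ⟨ContinuousLinearEquiv.unitsEquiv ℝ HPos a, rfl⟩ ⟨dualEquiv.toContinuousLinearEquiv, rfl⟩

theorem pairing_dirichletNeumann {η : W1inf} (hη : ‖η‖ < 1 / 2) (Φ : HPos) :
    pairing (dirichletNeumann η Φ) Φ = inner ℝ (Ring.inverse (neumannOp η) Φ) Φ := by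
  rw [dirichletNeumann_eq hη, pairing_eq]
  congr 1


end WaterWaves

end

theorem mainTheorem8 :
    (∀ η : WaterWaves.W1inf, ‖η‖ < 1 / 2 →
      WaterWaves.IsNeumannDirichlet η (WaterWaves.neumannDirichlet η)) ∧
    AnalyticAt ℝ WaterWaves.neumannDirichlet 0 ∧
    AnalyticAt ℝ WaterWaves.dirichletNeumann 0 ∧
    ∃ M c C : ℝ, 0 < M ∧ M ≤ 1 / 2 ∧ 0 < c ∧ 0 < C ∧
      ∀ η : WaterWaves.W1inf, ‖η‖ < M →
        (WaterWaves.neumannDirichlet η).IsInvertible ∧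
        ∀ Φ : WaterWaves.HPos,
          c * ‖Φ‖ ^ 2 ≤ WaterWaves.pairing (WaterWaves.dirichletNeumann η Φ) Φ ∧
          WaterWaves.pairing (WaterWaves.dirichletNeumann η Φ) Φ ≤ C * ‖Φ‖ ^ 2 := by
  refine ⟨fun η hη => (WaterWaves.neumannDirichlet_spec hη).1,
    WaterWaves.analyticAt_neumannDirichlet, WaterWaves.analyticAt_dirichletNeumann, ?_⟩
  obtain ⟨M, K, hM, hM', hK, hbound⟩ := WaterWaves.exists_coeffOp_bound
  set L : ℝ := 8 * ‖(WaterWaves.trace : WaterWaves.H1Star →L[ℝ] WaterWaves.HPos)‖ ^ 2 + 1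
  have hL : 0 < L := by positivity
  have ha : (0 : ℝ) < 1 / 24 / K ^ 2 := by positivity
  -- With `a = 1 / (24 K²)` the coercivity constant and `L` a positive norm bound of `neumannOp η`,
  -- the inverse has coercivity constant `a / L²` and norm at most `a⁻¹`.
  refine ⟨M, 1 / 24 / K ^ 2 / L ^ 2, (1 / 24 / K ^ 2)⁻¹, hM, hM', by positivity, by positivity,
    fun η hη => ?_⟩
  have hη' : ‖η‖ < 1 / 2 := hη.trans_le hM'
  have hco := WaterWaves.neumannOp_coercive hη' (hbound η hη) hK
  have hnorm : ‖WaterWaves.neumannOp η‖ ≤ L :=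
    ContinuousLinearMap.opNorm_le_bound _ hL.le fun ξ =>
      (WaterWaves.norm_neumannOp_apply_le hη' ξ).trans (by
        gcongr
        exact le_add_of_nonneg_right zero_le_one)
  refine ⟨WaterWaves.isInvertible_neumannDirichlet hη', fun Φ => ?_⟩
  rw [WaterWaves.pairing_dirichletNeumann hη']
  refine ⟨WaterWaves.ring_inverse_coercive ha hco hnorm hL Φ, ?_⟩
  calc _ ≤ ‖Ring.inverse (WaterWaves.neumannOp η) Φ‖ * ‖Φ‖ := real_inner_le_norm _ _
    _ ≤ (1 / 24 / K ^ 2)⁻¹ * ‖Φ‖ * ‖Φ‖ := by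
      gcongr
      exact WaterWaves.norm_ring_inverse_apply_le ha hco Φ
    _ = _ := by ring
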